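/- Let $(\Omega,\mathcal F,P)$ be a probability space. All sub-$\sigma$-fields of $\mathcal F$ below are understood to contain all $P$-null sets of $\mathcal F$; $\mathcal A\otimes\mathcal B$ denotes the $\sigma$-field generated by two sub-$\sigma$-fields $\mathcal A,\mathcal B$ and includes the assertion that they are independent. A *continuous factorization* is a family $(\mathcal F_{s,t})_{s\le t}$ $(s,t\in\mathbb R)$ of sub-$\sigma$-fields of $\mathcal F$ such that (a) $\mathcal F_{r,t}=\mathcal F_{r,s}\otimes\mathcal F_{s,t}$ whenever $r\le s\le t$; (b) $\bigcup_{\varepsilon>0}\mathcal F_{s+\varepsilon,t-\varepsilon}$ generates $\mathcal F_{s,t}$ whenever $s<t$ (over those $\varepsilon$ with $s+\varepsilon\le t-\varepsilon$); (c) $\bigcup_n\mathcal F_{-n,n}$ generates $\mathcal F$. An *elementary set* is a finite union of (bounded or unbounded) intervals of $\mathbb R$, treated modulo finite sets. For $E=(a_1,b_1)\cup\dots\cup(a_n,b_n)$ with $-\infty\le a_i, b_i\le\infty$, let $\mathcal F_E$ be the $\sigma$-field generated by $\mathcal F_{a_1,b_1},\dots,\mathcal F_{a_n,b_n}$, where for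 infinite endpoints $\mathcal F_{a,b}$ is generated by all $\mathcal F_{s,t}$ with $s\le t$ real, $a\le s$, $t\le b$ (and $\mathcal F_\emptyset$ is degenerate). Let $\mathcal C$ be the space of compact subsets of $\mathbb R$ (including $\emptyset$) with the Borel $\sigma$-field of the Hausdorff metric. The *spectral measure* of $f\in L_2(\Omega,\mathcal F,P)$ is the measure $\mu_f$ on $\mathcal C$ such that $\mu_f(\{M\in\mathcal C: M\subset E\})=\|\mathbb E(f\mid\mathcal F_E)\|^2$ for all elementary $E$. The element $f$ is *stable* if $\mu_f$ is concentrated on the finite sets $M\in\mathcal C$, and the factorization is *classical* if every $f\in L_2(\Omega,\mathcal F,P)$ is stable. **Theorem 6.21.** A continuous factorization is classical if and only if the map $E\mapsto\mathcal F_E$, defined on elementary sets, can be extended to all Borel sets $E\subset\mathbb R$ (with values in the sub-$\sigma$-fields of $\mathcal F$) in such a way that $$\mathcal F_{E_1\cup E_2}=\mathcal F_{E_1}\otimes\mathcal F_{E_2}\quad\text{whenever }E_1\cap E_2=\emptyset,$$ $$\mathcal F_{E_n}\uparrow\mathcal F_E\quad\text{whenever }E_n\uparrow E,$$ that is, $\mathcal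 F_E$ is generated by the union of the increasing sequence $(\mathcal F_{E_n})$. -/

import Mathlib

open MeasureTheory ProbabilityTheory

/-- A sub-σ-field of the ambient σ-field, containing (by the usual "mod 0" convention) every
`P`-null set of the ambient σ-field. With this convention, relations between sub-σ-fields that
are meant mod 0 are plain equalities. -/
structure IsSubSigmaField {Ω : Type*} [mΩ : MeasurableSpace Ω] (P : Measure Ω)
    (m : MeasurableSpace Ω) : Prop where
  le : m ≤ mΩ
  null : ∀ A : Set Ω, MeasurableSet[mΩ] A → P A = 0 → MeasurableSet[m] A

/-- The degenerate sub-σ-field: the one generated by the `P`-null sets. -/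
@[reducible] def degenerateField {Ω : Type*} [MeasurableSpace Ω] (P : Measure Ω) : MeasurableSpace Ω :=
  MeasurableSpace.generateFrom {A | MeasurableSet A ∧ P A = 0}

/-- A continuous factorization of probability spaces over `ℝ`: a family `(𝓕_{s,t})_{s ≤ t}` of
sub-σ-fields such that
(a) `𝓕_{r,t} = 𝓕_{r,s} ⊗ 𝓕_{s,t}` (the two are independent and generate `𝓕_{r,t}`);
(b) the union over `ε > 0` of `𝓕_{s+ε,t-ε}` generates `𝓕_{s,t}` for `s < t`;
(c) the union over `n` of `𝓕_{-n,n}` generates the whole σ-field.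
The values `field s t` for `t < s` play no role. -/
structure ContinuousFactorization {Ω : Type*} [mΩ : MeasurableSpace Ω] (P : Measure Ω) where
  field : ℝ → ℝ → MeasurableSpace Ω
  isSubSigmaField : ∀ s t : ℝ, s ≤ t → IsSubSigmaField P (field s t)
  indep : ∀ r s t : ℝ, r ≤ s → s ≤ t → Indep (field r s) (field s t) P
  sup_eq : ∀ r s t : ℝ, r ≤ s → s ≤ t → field r s ⊔ field s t = field r t
  continuous : ∀ s t : ℝ, s < t →
    ⨆ (ε : ℝ) (_ : 0 < ε ∧ s + ε ≤ t - ε), field (s + ε) (t - ε) = field s t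
  exhaust : ⨆ n : ℕ, field (-(n : ℝ)) (n : ℝ) = mΩ

/-- The open elementary set `(a₁,b₁) ∪ ⋯ ∪ (aₙ,bₙ)`; the endpoints may be infinite. Every
elementary set (finite union of intervals) differs from one of these by a finite set only. -/
def elementarySet (I : Finset (EReal × EReal)) : Set ℝ :=
  {x : ℝ | ∃ p ∈ I, p.1 < (x : EReal) ∧ (x : EReal) < p.2}

namespace ContinuousFactorization

/-- `𝓕_{a,b}` for possibly infinite endpoints: generated by all `𝓕_{s,t}` with `s ≤ t` real,
`a ≤ s` and `t ≤ b`. -/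
@[reducible] def intervalField {Ω : Type*} [MeasurableSpace Ω] {P : Measure Ω}
    (F : ContinuousFactorization P) (a b : EReal) : MeasurableSpace Ω :=
  ⨆ (s : ℝ) (t : ℝ) (_ : s ≤ t ∧ a ≤ (s : EReal) ∧ (t : EReal) ≤ b), F.field s t

/-- For real endpoints the above is just `𝓕_{a,b}`. -/
theorem intervalField_coe {Ω : Type*} [MeasurableSpace Ω] {P : Measure Ω}
    (F : ContinuousFactorization P) (a b : ℝ) (hab : a ≤ b) :
    F.intervalField a b = F.field a b := by
  apply le_antisymm
  · refine iSup_le fun s => iSup_le fun t => iSup_le fun h => ?_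
    obtain ⟨hst, has, htb⟩ := h
    have has : a ≤ s := EReal.coe_le_coe_iff.mp has
    have htb : t ≤ b := EReal.coe_le_coe_iff.mp htb
    rw [← F.sup_eq a s b has (hst.trans htb), ← F.sup_eq s t b hst htb]
    exact le_sup_left.trans le_sup_right
  · exact le_iSup_of_le a (le_iSup_of_le b (le_iSup_of_le ⟨hab, le_rfl, le_rfl⟩ le_rfl))

/-- `𝓕_E` for `E = (a₁,b₁) ∪ ⋯ ∪ (aₙ,bₙ)`: the σ-field generated by the `𝓕_{aᵢ,bᵢ}`
(the degenerate σ-field if there are no intervals). It depends on `E` modulo finite sets only. -/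
@[reducible] def elementaryField {Ω : Type*} [MeasurableSpace Ω] {P : Measure Ω}
    (F : ContinuousFactorization P) (I : Finset (EReal × EReal)) : MeasurableSpace Ω :=
  degenerateField P ⊔ ⨆ p ∈ I, F.intervalField p.1 p.2

end ContinuousFactorization

/-- The space of compact subsets of `ℝ` (including `∅`) carries the Borel σ-field of its
Hausdorff-metric (Vietoris) topology. -/
instance compactsRealMeasurableSpace : MeasurableSpace (TopologicalSpace.Compacts ℝ) :=
  borel (TopologicalSpace.Compacts ℝ)

namespace ContinuousFactorization

/-- `μ` is the spectral measure of the square integrable random variable `f`: the measure on the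
space of compact sets such that `μ {M | M ⊆ E} = ‖𝔼[f | 𝓕_E]‖²` for every elementary set `E`.
(For `E = ℝ` this gives total mass `‖f‖²`, so `μ` is finite.) -/
def IsSpectralMeasure {Ω : Type*} [MeasurableSpace Ω] {P : Measure Ω}
    (F : ContinuousFactorization P) (f : Ω → ℝ)
    (μ : Measure (TopologicalSpace.Compacts ℝ)) : Prop :=
  ∀ I : Finset (EReal × EReal),
    μ {M | (M : Set ℝ) ⊆ elementarySet I} = eLpNorm (P[f | F.elementaryField I]) 2 P ^ 2

/-- `f` is stable: its spectral measure is concentrated on the finite sets. -/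
def IsStable {Ω : Type*} [MeasurableSpace Ω] {P : Measure Ω}
    (F : ContinuousFactorization P) (f : Ω → ℝ) : Prop :=
  ∃ μ : Measure (TopologicalSpace.Compacts ℝ),
    F.IsSpectralMeasure f μ ∧ μ {M | ¬ (M : Set ℝ).Finite} = 0

/-- A continuous factorization is classical if every element of `L₂` is stable. -/
def IsClassical {Ω : Type*} [MeasurableSpace Ω] {P : Measure Ω}
    (F : ContinuousFactorization P) : Prop :=
  ∀ f : Ω → ℝ, MemLp f 2 P → F.IsStable f

/-- `G` is an extension of `E ↦ 𝓕_E` from elementary sets to all Borel sets, sending disjoint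
unions to independent products and increasing unions to generated σ-fields.
The values of `G` on non-Borel sets play no role. -/
structure IsBorelExtension {Ω : Type*} [MeasurableSpace Ω] {P : Measure Ω}
    (F : ContinuousFactorization P) (G : Set ℝ → MeasurableSpace Ω) : Prop where
  isSubSigmaField : ∀ E : Set ℝ, MeasurableSet E → IsSubSigmaField P (G E)
  /-- `G E = 𝓕_E` for elementary `E`, which are treated modulo finite sets. -/
  eq_elementaryField : ∀ (I : Finset (EReal × EReal)) (E : Set ℝ),
    (symmDiff E (elementarySet I)).Finite → G E = F.elementaryField I
  indep : ∀ E₁ E₂ : Set ℝ, MeasurableSet E₁ → MeasurableSet E₂ → Disjoint E₁ E₂ →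
    Indep (G E₁) (G E₂) P
  union : ∀ E₁ E₂ : Set ℝ, MeasurableSet E₁ → MeasurableSet E₂ → Disjoint E₁ E₂ →
    G (E₁ ∪ E₂) = G E₁ ⊔ G E₂
  /-- `G (E n) ↑ G E` whenever `E n ↑ E` (that `G (E n)` increases follows from `union`). -/
  iUnion : ∀ E : ℕ → Set ℝ, (∀ n, MeasurableSet (E n)) → Monotone E →
    G (⋃ n, E n) = ⨆ n, G (E n)

end ContinuousFactorization

/-! ### Conditional expectation as a projection of `L²`, and lattices of independent σ-fields. -/

section Toolbox
open Filter Topology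
open scoped ENNReal

/-! From an extension to classicality. Given an extension `G`, the operators `Z E = 𝔼[· | G Eᶜ]` on
`L²` are commuting projections with `Z (E ∪ F) = Z E ∘ Z F`, continuous along monotone sequences of
Borel sets, and `Z {a} = 1`. For a vector `f` one builds a random compact set `M` that avoids each
open `U` with mass `‖Z U f‖²`; its law is the spectral measure. It must be shown that `M` is almost
surely finite.

Continuity over all Borel sets yields a finite measure `ν` on `ℝ` such that open sets of small
`ν`-measure are rarely hit by `M` (`IsRandomSpectrum.exists_control`); `ν` is a mixture of the laws
of the leftmost points of `M` in rational intervals. Now cut the line into cells and keep each with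
a small probability `p`. The kept union has small expected `ν`-measure, so it is rarely hit; but if
`M` meets many cells, the kept union is almost surely hit. Hence the number of cells met is bounded
in probability, uniformly over the partitions (`measureReal_hitCells_le`), and refining the grid
excludes infinite `M`.

From classicality to an extension. Attach to a compact set the intersection of the σ-fields of its
neighbourhoods, and to any set the σ-field generated by its compact subsets. Disjoint sets then get
independent σ-fields by topological separation alone. Additivity needs finite spectra: a finite set
missing `⋂ V n` misses `V n` for large `n`, so hitting masses are continuous along decreasing open
sets, and every Borel set lies between a closed and an open set whose difference is rarely hit. It
follows that the σ-fields of a countable Borel cover generate everything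
(`IsClassical.le_of_iUnion_eq_univ`). Since `E` and `Eᶜ` carry independent σ-fields, pieces of `E`
that generate everything together with `Eᶜ` must generate all of the σ-field of `E`
(`eq_of_indep_of_sup_eq`). -/

/-- Orthogonal projections onto a decreasing sequence of closed subspaces converge strongly to the
projection onto the intersection. -/
theorem starProjection_tendsto_iInf {E : Type*} [NormedAddCommGroup E] [InnerProductSpace ℝ E]
    [CompleteSpace E] (S : ℕ → Submodule ℝ E) [∀ i, (S i).HasOrthogonalProjection]
    [(⨅ i, S i).HasOrthogonalProjection] (hS : Antitone S) (x : E) :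
    Tendsto (fun i => (S i).starProjection x) atTop (𝓝 ((⨅ i, S i).starProjection x)) := by
  have h := Submodule.starProjection_tendsto_closure_iSup (fun i => (S i)ᗮ)
    (fun i j hij => Submodule.orthogonal_le (hS hij)) x
  have h2 : (⨆ i, (S i)ᗮ).topologicalClosure = (⨅ i, S i)ᗮ := by
    rw [← Submodule.orthogonal_orthogonal_eq_closure, ← Submodule.iInf_orthogonal]
    simp
  have h3 : (⨆ i, (S i)ᗮ).topologicalClosure.starProjection x
      = x - (⨅ i, S i).starProjection x := by
    simp only [h2]
    rw [Submodule.starProjection_orthogonal']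
    simp
  rw [h3] at h
  have h4 := (tendsto_const_nhds (x := x)).sub h
  simp only [sub_sub_cancel] at h4
  refine h4.congr fun i => ?_
  rw [Submodule.starProjection_orthogonal']
  simp

/-- The π-system generating `A ⊔ B`. -/
theorem sup_eq_generateFrom_inter {Ω : Type*} (A B : MeasurableSpace Ω) :
    A ⊔ B = MeasurableSpace.generateFrom
      {s | ∃ a b, MeasurableSet[A] a ∧ MeasurableSet[B] b ∧ s = a ∩ b} := by
  apply le_antisymm
  · apply sup_le
    · exact fun s hs => MeasurableSpace.measurableSet_generateFrom
        ⟨s, Set.univ, hs, @MeasurableSet.univ _ B, by simp⟩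
    · exact fun s hs => MeasurableSpace.measurableSet_generateFrom
        ⟨Set.univ, s, @MeasurableSet.univ _ A, hs, by simp⟩
  · refine MeasurableSpace.generateFrom_le ?_
    rintro _ ⟨a, b, ha, hb, rfl⟩
    exact @MeasurableSet.inter _ (A ⊔ B) _ _ ((le_sup_left : A ≤ A ⊔ B) _ ha)
      ((le_sup_right : B ≤ A ⊔ B) _ hb)

theorem isPiSystem_inter {Ω : Type*} (A B : MeasurableSpace Ω) :
    IsPiSystem {s : Set Ω | ∃ a b, MeasurableSet[A] a ∧ MeasurableSet[B] b ∧ s = a ∩ b} := by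
  rintro _ ⟨a, b, ha, hb, rfl⟩ _ ⟨a', b', ha', hb', rfl⟩ -
  exact ⟨a ∩ a', b ∩ b', ha.inter ha', hb.inter hb', by
    rw [Set.inter_inter_inter_comm]⟩

variable {Ω : Type*} {m m' A B C : MeasurableSpace Ω} [mΩ : MeasurableSpace Ω] {P : Measure Ω}

theorem IsSubSigmaField.measurableSet_of_ae_eq (hm : IsSubSigmaField P m)
    {s t : Set Ω} (hs : MeasurableSet s) (ht : MeasurableSet[m] t) (hst : s =ᵐ[P] t) :
    MeasurableSet[m] s := by
  have ht' : MeasurableSet t := hm.le _ ht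
  have h1 : P (s \ t) = 0 := (ae_le_set.1 hst.le)
  have h2 : P (t \ s) = 0 := (ae_le_set.1 hst.symm.le)
  have : s = (t \ (t \ s)) ∪ (s \ t) := by
    ext x; by_cases h : x ∈ s <;> by_cases h' : x ∈ t <;> simp [h, h']
  rw [this]
  exact (ht.diff (hm.null _ (ht'.diff hs) h2)).union (hm.null _ (hs.diff ht') h1)

theorem IsSubSigmaField.measurable_of_aestronglyMeasurable
    (hm : IsSubSigmaField P m) {f : Ω → ℝ} (hf : Measurable f)
    (hf' : AEStronglyMeasurable[m] f P) : Measurable[m] f := by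
  obtain ⟨g, hg, hfg⟩ := hf'
  intro s hs
  refine hm.measurableSet_of_ae_eq (hf hs) (hg.measurable hs) ?_
  exact Filter.eventuallyEq_set.2 (hfg.mono fun x hx => by simp [hx])

theorem IsSubSigmaField.iInf {ι : Type*} [Nonempty ι] {m : ι → MeasurableSpace Ω}
    (hm : ∀ i, IsSubSigmaField P (m i)) : IsSubSigmaField P (⨅ i, m i) where
  le := (iInf_le _ (Classical.arbitrary ι)).trans (hm _).le
  null A hA h0 := by
    rw [MeasurableSpace.measurableSet_iInf]
    exact fun i => (hm i).null A hA h0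

theorem IsSubSigmaField.mono (hm : IsSubSigmaField P m)
    (h : m ≤ m') (h' : m' ≤ mΩ) : IsSubSigmaField P m' :=
  ⟨h', fun A hA h0 => h _ (hm.null A hA h0)⟩

theorem IsSubSigmaField.iSup {ι : Type*} [Nonempty ι] {m : ι → MeasurableSpace Ω}
    (hm : ∀ i, IsSubSigmaField P (m i)) : IsSubSigmaField P (⨆ i, m i) :=
  (hm (Classical.arbitrary ι)).mono (le_iSup m _) (iSup_le fun i => (hm i).le)

theorem IsSubSigmaField.sup (hm : IsSubSigmaField P m)
    (h : m' ≤ mΩ) : IsSubSigmaField P (m ⊔ m') :=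
  hm.mono le_sup_left (sup_le hm.le h)

theorem isSubSigmaField_degenerateField : IsSubSigmaField P (degenerateField P) where
  le := MeasurableSpace.generateFrom_le fun _ h => h.1
  null _ hA h0 := MeasurableSpace.measurableSet_generateFrom ⟨hA, h0⟩

theorem IsSubSigmaField.degenerateField_le (hm : IsSubSigmaField P m) :
    degenerateField P ≤ m :=
  MeasurableSpace.generateFrom_le fun A h => hm.null A h.1 h.2

/-- Conditional expectation as an operator on `L²`. -/
noncomputable def condProj (m : MeasurableSpace Ω) {mΩ : MeasurableSpace Ω} (P : Measure Ω) :
    Lp ℝ 2 P →L[ℝ] Lp ℝ 2 P :=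
  -- The closure makes the projection available for every `m`; when `m ≤ mΩ` the subspace is already
  -- closed.
  (lpMeas ℝ ℝ m 2 P).topologicalClosure.starProjection

theorem topologicalClosure_lpMeas (hm : m ≤ mΩ) :
    (lpMeas ℝ ℝ m 2 P).topologicalClosure = lpMeas ℝ ℝ m 2 P := by
  apply IsClosed.submodule_topologicalClosure_eq
  exact isClosed_aestronglyMeasurable hm

theorem condProj_mem (hm : m ≤ mΩ) (f : Lp ℝ 2 P) :
    AEStronglyMeasurable[m] (condProj m P f) P := by
  have : condProj m P f ∈ (lpMeas ℝ ℝ m 2 P).topologicalClosure :=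
    Submodule.starProjection_apply_mem _ _
  rw [topologicalClosure_lpMeas hm] at this
  exact mem_lpMeas_iff_aestronglyMeasurable.1 this

theorem condProj_eq_self (hm : m ≤ mΩ) {f : Lp ℝ 2 P}
    (hf : AEStronglyMeasurable[m] f P) : condProj m P f = f := by
  rw [condProj, Submodule.starProjection_eq_self_iff, topologicalClosure_lpMeas hm]
  exact mem_lpMeas_iff_aestronglyMeasurable.2 hf

theorem condProj_ae_eq [IsFiniteMeasure P] (hm : m ≤ mΩ) (f : Lp ℝ 2 P) :
    condProj m P f =ᵐ[P] P[f | m] := by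
  have h1 : condProj m P f = condExpL2 ℝ ℝ hm f := by
    have : Fact (m ≤ mΩ) := ⟨hm⟩
    rw [condProj]
    simp only [topologicalClosure_lpMeas hm]
    rfl
  have h2 := (Lp.memLp f).condExpL2_ae_eq_condExp (𝕜 := ℝ) hm
  rw [Lp.toLp_coeFn] at h2
  rw [h1]
  exact h2

theorem condProj_toLp [IsFiniteMeasure P] (hm : m ≤ mΩ) {f : Ω → ℝ}
    (hf : MemLp f 2 P) : condProj m P (hf.toLp f) =ᵐ[P] P[f | m] :=
  (condProj_ae_eq hm _).trans (condExp_congr_ae hf.coeFn_toLp)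

theorem eLpNorm_condExp_eq [IsFiniteMeasure P] (hm : m ≤ mΩ) {f : Ω → ℝ}
    (hf : MemLp f 2 P) :
    eLpNorm (P[f | m]) 2 P ^ 2 = ENNReal.ofReal (‖condProj m P (hf.toLp f)‖ ^ 2) := by
  rw [← eLpNorm_congr_ae (condProj_toLp hm hf), ENNReal.ofReal_pow (norm_nonneg _),
    ofReal_norm, Lp.enorm_def]

theorem condProj_norm_sq (f : Lp ℝ 2 P) :
    ‖f‖ ^ 2 = ‖condProj m P f‖ ^ 2 + ‖f - condProj m P f‖ ^ 2 := by
  have h := Submodule.norm_sq_eq_add_norm_sq_starProjection f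
    (lpMeas ℝ ℝ m 2 P).topologicalClosure
  rw [Submodule.starProjection_orthogonal'] at h
  simpa [condProj] using h

theorem inner_condProj_left (f g : Lp ℝ 2 P) :
    inner ℝ (condProj m P f) g = inner ℝ f (condProj m P g) :=
  Submodule.inner_starProjection_left_eq_right _ _ _

theorem norm_condProj_le (f : Lp ℝ 2 P) : ‖condProj m P f‖ ≤ ‖f‖ := by
  have := condProj_norm_sq (m := m) f
  exact le_of_sq_le_sq (by nlinarith [sq_nonneg ‖f - condProj m P f‖]) (norm_nonneg _)

theorem condProj_condProj_of_le (hm' : m' ≤ mΩ) (h : m ≤ m')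
    (f : Lp ℝ 2 P) : condProj m' P (condProj m P f) = condProj m P f :=
  condProj_eq_self hm' ((condProj_mem (h.trans hm') f).mono h)

theorem condProj_condProj_of_le' (hm' : m' ≤ mΩ) (h : m ≤ m')
    (f : Lp ℝ 2 P) : condProj m P (condProj m' P f) = condProj m P f := by
  refine ext_inner_right ℝ fun g => ?_
  rw [inner_condProj_left, inner_condProj_left, condProj_condProj_of_le hm' h,
    inner_condProj_left]

theorem norm_condProj_mono (hm' : m' ≤ mΩ) (h : m ≤ m')
    (f : Lp ℝ 2 P) : ‖condProj m P f‖ ≤ ‖condProj m' P f‖ := by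
  rw [← condProj_condProj_of_le' hm' h]
  exact norm_condProj_le _

/-- Decreasing sequences of sub-σ-fields. -/
theorem condProj_tendsto_iInf {m : ℕ → MeasurableSpace Ω} (hm : ∀ n, IsSubSigmaField P (m n))
    (hanti : Antitone m) (f : Lp ℝ 2 P) :
    Tendsto (fun n => condProj (m n) P f) atTop (𝓝 (condProj (⨅ n, m n) P f)) := by
  have h2 : (⨅ n, (lpMeas ℝ ℝ (m n) 2 P).topologicalClosure)
      = (lpMeas ℝ ℝ (⨅ n, m n) 2 P).topologicalClosure := by
    rw [topologicalClosure_lpMeas (IsSubSigmaField.iInf hm).le]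
    simp_rw [fun n => topologicalClosure_lpMeas (P := P) (hm n).le]
    ext g
    simp only [Submodule.mem_iInf, mem_lpMeas_iff_aestronglyMeasurable]
    constructor
    · intro hg
      obtain ⟨g', hg', hgg'⟩ := Lp.aestronglyMeasurable g
      refine ⟨g', Measurable.stronglyMeasurable ?_, hgg'⟩
      intro s hs
      rw [MeasurableSpace.measurableSet_iInf]
      exact fun n => (hm n).measurable_of_aestronglyMeasurable hg'.measurable
        ((hg n).congr hgg') hs
    · exact fun hg n => hg.mono (iInf_le _ n)
  have : (⨅ n, (lpMeas ℝ ℝ (m n) 2 P).topologicalClosure).HasOrthogonalProjection := by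
    rw [h2]; infer_instance
  have h := starProjection_tendsto_iInf (fun n => (lpMeas ℝ ℝ (m n) 2 P).topologicalClosure)
    (fun i j hij => by
      dsimp only
      rw [topologicalClosure_lpMeas (hm i).le, topologicalClosure_lpMeas (hm j).le]
      intro g hg
      rw [mem_lpMeas_iff_aestronglyMeasurable] at hg ⊢
      exact hg.mono (hanti hij)) f
  simp only [h2] at h
  exact h

/-- Integrals over sets of `A ⊔ B` are determined by those over `a ∩ b`. -/
theorem setIntegral_eq_of_sup (hA : A ≤ mΩ) (hB : B ≤ mΩ) {f g : Ω → ℝ}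
    (hf : Integrable f P) (hg : Integrable g P)
    (h : ∀ a b, MeasurableSet[A] a → MeasurableSet[B] b →
      ∫ x in a ∩ b, f x ∂P = ∫ x in a ∩ b, g x ∂P) {s : Set Ω} (hs : MeasurableSet[A ⊔ B] s) :
    ∫ x in s, f x ∂P = ∫ x in s, g x ∂P := by
  have hle : A ⊔ B ≤ mΩ := sup_le hA hB
  have huniv : ∫ x, f x ∂P = ∫ x, g x ∂P := by
    have := h Set.univ Set.univ (@MeasurableSet.univ _ A) (@MeasurableSet.univ _ B)
    simpa using this
  refine MeasurableSpace.induction_on_inter (m := A ⊔ B)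
    (C := fun s _ => ∫ x in s, f x ∂P = ∫ x in s, g x ∂P)
    (sup_eq_generateFrom_inter A B) (isPiSystem_inter A B) (by simp) ?_ ?_ ?_ s hs
  · rintro _ ⟨a, b, ha, hb, rfl⟩
    exact h a b ha hb
  · intro t ht hft
    have h1 := integral_add_compl (hle _ ht) hf
    have h2 := integral_add_compl (hle _ ht) hg
    linarith
  · intro t hd ht hft
    rw [integral_iUnion (fun i => hle _ (ht i)) hd hf.integrableOn,
      integral_iUnion (fun i => hle _ (ht i)) hd hg.integrableOn]
    simp only [hft]

/-- If `f` is integrable and measurable with respect to a σ-field independent of `C`, then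
integrals over `C`-measurable sets factorize. -/
theorem setIntegral_of_indep [IsProbabilityMeasure P] (hA : A ≤ mΩ)
    (hC : C ≤ mΩ) (hind : Indep A C P) {f : Ω → ℝ} (hf : Integrable f P)
    (hfA : StronglyMeasurable[A] f) {c : Set Ω} (hc : MeasurableSet[C] c) :
    ∫ x in c, f x ∂P = P.real c * ∫ x, f x ∂P := by
  rw [← setIntegral_condExp hC hf hc,
    setIntegral_congr_ae (g := fun _ => ∫ x, f x ∂P) (hC _ hc)
      ((condExp_indep_eq hA hC hfA hind).mono fun x hx _ => hx)]
  simp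

/-- If `B ≤ A` and `A` is independent of `C`, then conditioning an `A`-measurable function on
`B ⊔ C` amounts to conditioning it on `B`. -/
theorem condExp_sup_of_indep [IsProbabilityMeasure P] (hA : A ≤ mΩ)
    (hC : C ≤ mΩ) (hBA : B ≤ A) (hind : Indep A C P) {f : Ω → ℝ} (hf : Integrable f P)
    (hfA : StronglyMeasurable[A] f) : P[f | B ⊔ C] =ᵐ[P] P[f | B] := by
  have hB : B ≤ mΩ := hBA.trans hA
  refine (ae_eq_condExp_of_forall_setIntegral_eq (sup_le hB hC) hf
    (fun s _ _ => integrable_condExp.integrableOn) (fun s hs _ => ?_)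
    (stronglyMeasurable_condExp.mono (le_sup_left : B ≤ B ⊔ C)).aestronglyMeasurable).symm
  refine setIntegral_eq_of_sup hB hC integrable_condExp hf ?_ hs
  intro b c hb hc
  have key : ∀ g : Ω → ℝ, Integrable g P → StronglyMeasurable[A] g →
      ∫ x in b ∩ c, g x ∂P = P.real c * ∫ x in b, g x ∂P := by
    intro g hg hgA
    rw [Set.inter_comm, ← setIntegral_indicator (hB _ hb), ← integral_indicator (hB _ hb)]
    exact setIntegral_of_indep hA hC hind (hg.indicator (hB _ hb))
      (hgA.indicator (hBA _ hb)) hc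
  rw [key _ integrable_condExp (stronglyMeasurable_condExp.mono hBA), key _ hf hfA,
    setIntegral_condExp hB hf hb]

theorem condProj_sup_of_indep [IsProbabilityMeasure P] (hA : A ≤ mΩ)
    (hC : C ≤ mΩ) (hBA : B ≤ A) (hind : Indep A C P) {f : Lp ℝ 2 P}
    (hf : AEStronglyMeasurable[A] f P) : condProj (B ⊔ C) P f = condProj B P f := by
  obtain ⟨g, hg, hfg⟩ := hf
  have hfi : Integrable f P := (Lp.memLp f).integrable (by norm_num)
  apply Lp.ext
  refine (condProj_ae_eq (sup_le (hBA.trans hA) hC) f).trans ?_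
  refine Filter.EventuallyEq.trans ?_ (condProj_ae_eq (hBA.trans hA) f).symm
  refine (condExp_congr_ae hfg).trans ?_
  refine Filter.EventuallyEq.trans ?_ (condExp_congr_ae hfg.symm)
  exact condExp_sup_of_indep hA hC hBA hind (hfi.congr hfg) hg

theorem integrable_indicator_one [IsFiniteMeasure P] {t : Set Ω} (ht : MeasurableSet t) :
    Integrable (t.indicator (fun _ => (1 : ℝ))) P :=
  (integrable_const _).indicator ht

theorem memLp_indicator_one [IsFiniteMeasure P] {t : Set Ω} (ht : MeasurableSet t) :
    MemLp (t.indicator (fun _ => (1 : ℝ))) 2 P :=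
  (memLp_const _).indicator ht

/-- Self-adjointness of conditional expectation, tested on two indicators. -/
theorem setIntegral_condExp_indicator_comm [IsFiniteMeasure P] (hB : B ≤ mΩ) {t u : Set Ω}
    (ht : MeasurableSet t) (hu : MeasurableSet u) :
    ∫ x in t, (P[u.indicator (fun _ => (1 : ℝ)) | B]) x ∂P
      = ∫ x in u, (P[t.indicator (fun _ => (1 : ℝ)) | B]) x ∂P := by
  have h1 : ∀ t u (ht : MeasurableSet t) (hu : MeasurableSet u),
      ∫ x in t, (P[u.indicator (fun _ => (1 : ℝ)) | B]) x ∂P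
        = inner ℝ ((memLp_indicator_one ht).toLp _)
            (condProj B P ((memLp_indicator_one hu).toLp _)) := by
    intro t u ht hu
    rw [L2.inner_def, ← integral_indicator ht]
    refine integral_congr_ae ?_
    filter_upwards [condProj_toLp hB (memLp_indicator_one hu),
      (memLp_indicator_one ht).coeFn_toLp] with x h1 h2
    rw [h1, h2]
    by_cases hx : x ∈ t <;> simp [hx]
  rw [h1 t u ht hu, h1 u t hu ht, ← inner_condProj_left, real_inner_comm]

theorem condExp_indicator_inter_sup [IsProbabilityMeasure P] (hA : A ≤ mΩ) (hC : C ≤ mΩ)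
    (hBA : B ≤ A) (hind : Indep A C P) {a c : Set Ω} (ha : MeasurableSet[A] a)
    (hc : MeasurableSet[C] c) :
    P[(a ∩ c).indicator (fun _ => (1 : ℝ)) | B ⊔ C]
      =ᵐ[P] c.indicator (P[a.indicator (fun _ => (1 : ℝ)) | B]) := by
  have hai := integrable_indicator_one (P := P) (hA _ ha)
  have h1 : (a ∩ c).indicator (fun _ => (1 : ℝ)) = c.indicator (a.indicator (fun _ => (1 : ℝ))) := by
    rw [Set.indicator_indicator, Set.inter_comm]
  rw [h1]
  refine (condExp_indicator hai ((le_sup_right : C ≤ B ⊔ C) _ hc)).trans ?_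
  have h2 := condExp_sup_of_indep hA hC hBA hind hai (stronglyMeasurable_const.indicator ha)
  filter_upwards [h2] with x hx
  by_cases hxc : x ∈ c <;> simp [hxc, hx]

/-- Isolates the dependence on `B` in a projection applied to a fixed vector, so that a limit in `B`
can be taken while `C` stays fixed. -/
theorem setIntegral_inter_condExp_sup [IsProbabilityMeasure P] (hA : A ≤ mΩ) (hC : C ≤ mΩ)
    (hBA : B ≤ A) (hind : Indep A C P) {a c s : Set Ω} (ha : MeasurableSet[A] a)
    (hc : MeasurableSet[C] c) (hs : MeasurableSet s) :
    ∫ x in a ∩ c, (P[s.indicator (fun _ => (1 : ℝ)) | B ⊔ C]) x ∂P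
      = inner ℝ ((memLp_indicator_one (P := P) (hs.inter (hC _ hc))).toLp _)
          (condProj B P ((memLp_indicator_one (hA _ ha)).toLp _)) := by
  rw [setIntegral_condExp_indicator_comm (sup_le (hBA.trans hA) hC) ((hA _ ha).inter (hC _ hc)) hs,
    L2.inner_def, ← integral_indicator hs]
  refine integral_congr_ae ?_
  filter_upwards [condProj_toLp (hBA.trans hA) (memLp_indicator_one (P := P) (hA _ ha)),
    (memLp_indicator_one (P := P) (hs.inter (hC _ hc))).coeFn_toLp,
    condExp_indicator_inter_sup hA hC hBA hind ha hc] with x h1 h2 h3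
  rw [h1, h2]
  by_cases hx : x ∈ s <;> by_cases hx' : x ∈ c <;> simp [hx, hx', h3]

/-- If the indicator of `s` is a.e. equal to its conditional expectation, then `s` belongs to the
conditioning σ-field. -/
theorem IsSubSigmaField.measurableSet_of_condExp (hm : IsSubSigmaField P m) {s : Set Ω}
    (hs : MeasurableSet s) {f : Ω → ℝ} (hf : StronglyMeasurable[m] f)
    (h : s.indicator (fun _ => (1 : ℝ)) =ᵐ[P] f) : MeasurableSet[m] s := by
  have hmeas : Measurable[m] (s.indicator (fun _ => (1 : ℝ))) :=
    hm.measurable_of_aestronglyMeasurable (measurable_const.indicator hs) ⟨_, hf, h⟩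
  have := hmeas (measurableSet_singleton (1 : ℝ))
  convert this using 1
  ext x
  by_cases hx : x ∈ s <;> simp [hx]

/-- A σ-field `A ≤ B` is all of `B` if, together with a σ-field independent of `B`, it generates
everything. -/
theorem eq_of_indep_of_sup_eq [IsProbabilityMeasure P]
    (hA : IsSubSigmaField P A) (hB : B ≤ mΩ)
    (hC : C ≤ mΩ) (hAB : A ≤ B) (hind : Indep B C P) (hgen : B ≤ A ⊔ C) : A = B := by
  refine le_antisymm hAB fun s hs => ?_
  have hsΩ := hB _ hs
  have hf := integrable_indicator_one (P := P) hsΩ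
  have hfB : StronglyMeasurable[B] (s.indicator (fun _ => (1 : ℝ))) :=
    stronglyMeasurable_const.indicator hs
  have h := condExp_sup_of_indep hB hC hAB hind hf hfB
  rw [condExp_of_stronglyMeasurable (sup_le hA.le hC) (hfB.mono hgen) hf] at h
  exact hA.measurableSet_of_condExp hsΩ stronglyMeasurable_condExp h

/-- Intersections of decreasing sequences commute with joining an independent σ-field. -/
theorem iInf_sup_le_of_indep [IsProbabilityMeasure P]
    {m : ℕ → MeasurableSpace Ω} (hm : ∀ n, IsSubSigmaField P (m n)) (hanti : Antitone m)
    (hA : A ≤ mΩ) (hmA : ∀ n, m n ≤ A) (hC : C ≤ mΩ) (hind : Indep A C P) :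
    ⨅ n, (m n ⊔ C) ≤ (⨅ n, m n) ⊔ C := by
  intro s hs
  have hs' : ∀ n, MeasurableSet[m n ⊔ C] s := by
    rwa [MeasurableSpace.measurableSet_iInf] at hs
  have hDC : IsSubSigmaField P ((⨅ n, m n) ⊔ C) := (IsSubSigmaField.iInf hm).sup hC
  have hDA : ⨅ n, m n ≤ A := (iInf_le m 0).trans (hmA 0)
  have hsΩ : MeasurableSet s := (sup_le (hm 0).le hC) _ (hs' 0)
  have hsi := integrable_indicator_one (P := P) hsΩ
  have hval : ∀ a c, MeasurableSet[A] a → MeasurableSet[C] c →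
      ∫ x in a ∩ c, s.indicator (fun _ => (1 : ℝ)) x ∂P
        = ∫ x in a ∩ c, (P[s.indicator (fun _ => (1 : ℝ)) | (⨅ n, m n) ⊔ C]) x ∂P := by
    intro a c ha hc
    -- Along `m n` the inner product does not vary: `s` lies in every `m n ⊔ C`, so each term is the
    -- integral of the indicator of `s` itself. The limit therefore has the same value.
    have hlim := (tendsto_const_nhds
      (x := (memLp_indicator_one (P := P) (hsΩ.inter (hC _ hc))).toLp _)).inner (𝕜 := ℝ)
      (condProj_tendsto_iInf hm hanti ((memLp_indicator_one (hA _ ha)).toLp _))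
    rw [← setIntegral_inter_condExp_sup hA hC hDA hind ha hc hsΩ] at hlim
    refine tendsto_nhds_unique (Tendsto.congr (fun n => ?_) tendsto_const_nhds) hlim
    rw [← setIntegral_inter_condExp_sup hA hC (hmA n) hind ha hc hsΩ,
      condExp_of_stronglyMeasurable (sup_le (hm n).le hC)
        (stronglyMeasurable_const.indicator (hs' n)) hsi]
  have hAC : A ⊔ C ≤ mΩ := sup_le hA hC
  have hsAC : MeasurableSet[A ⊔ C] s := (sup_le_sup_right (hmA 0) C) _ (hs' 0)
  have hae := ae_eq_condExp_of_forall_setIntegral_eq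
    (g := P[s.indicator (fun _ => (1 : ℝ)) | (⨅ n, m n) ⊔ C]) hAC hsi
    (fun _ _ _ => integrable_condExp.integrableOn)
    (fun t ht _ => (setIntegral_eq_of_sup hA hC hsi integrable_condExp hval ht).symm)
    (stronglyMeasurable_condExp.mono (sup_le_sup_right hDA C)).aestronglyMeasurable
  rw [condExp_of_stronglyMeasurable hAC (stronglyMeasurable_const.indicator hsAC) hsi] at hae
  exact hDC.measurableSet_of_condExp hsΩ stronglyMeasurable_condExp hae.symm

end Toolbox

/-! ### Increasing limits of σ-fields. -/

section Increasing
open Filter Topology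
open scoped ENNReal

variable {Ω : Type*} [mΩ : MeasurableSpace Ω] {P : Measure Ω}

/-- Increasing sequences of sub-σ-fields. -/
theorem condProj_tendsto_iSup [IsProbabilityMeasure P] {m : ℕ → MeasurableSpace Ω}
    (hm : ∀ n, m n ≤ mΩ) (hmono : Monotone m) (f : Lp ℝ 2 P) :
    Tendsto (fun n => condProj (m n) P f) atTop (𝓝 (condProj (⨆ n, m n) P f)) := by
  have h := Submodule.starProjection_tendsto_closure_iSup
    (fun n => (lpMeas ℝ ℝ (m n) 2 P).topologicalClosure)
    (fun i j hij => by
      dsimp only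
      rw [topologicalClosure_lpMeas (hm i), topologicalClosure_lpMeas (hm j)]
      intro g hg
      rw [mem_lpMeas_iff_aestronglyMeasurable] at hg ⊢
      exact hg.mono (hmono hij)) f
  change Tendsto (fun n => condProj (m n) P f) atTop _ at h
  let ℱ : Filtration ℕ mΩ := ⟨m, hmono, hm⟩
  have hle : ⨆ n, m n ≤ mΩ := iSup_le hm
  -- The Hilbert space limit projects onto a closed span that has yet to be identified. Martingale
  -- convergence supplies the almost sure limit, and uniqueness of limits in measure matches the
  -- two.
  have h1 : ∀ᵐ x ∂P, Tendsto (fun n => condProj (m n) P f x) atTop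
      (𝓝 (condProj (⨆ n, m n) P f x)) := by
    have h2 : ∀ᵐ x ∂P, ∀ n, condProj (m n) P f x = (P[f | m n]) x :=
      ae_all_iff.2 fun n => condProj_ae_eq (hm n) f
    filter_upwards [tendsto_ae_condExp (ℱ := ℱ) (μ := P) f, h2, condProj_ae_eq hle f]
      with x hx h2 h3
    rw [h3]
    exact hx.congr fun n => (h2 n).symm
  have h3 := tendstoInMeasure_of_tendsto_ae (fun n => Lp.aestronglyMeasurable _) h1
  have h4 := tendstoInMeasure_of_tendsto_Lp h
  rw [Lp.ext (tendstoInMeasure_ae_unique h3 h4)]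
  exact h

end Increasing

/-! ### Realizing commuting projections as events. -/

section Events
open Filter Topology Set
open scoped ENNReal

variable {H : Type*} [NormedAddCommGroup H] [InnerProductSpace ℝ H]

/-- Successive subdivision of the interval `[l, l + ‖g‖²)` according to a sequence of projections:
the `n`-th digit of the point `u`. -/
def projDigit : ℕ → (ℕ → H →L[ℝ] H) → ℝ → H → ℝ → Prop
  | 0, R, l, g, u => u < l + ‖R 0 g‖ ^ 2
  | n + 1, R, l, g, u =>
    (u < l + ‖R 0 g‖ ^ 2 ∧ projDigit n (fun i => R (i + 1)) l (R 0 g) u) ∨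
    (l + ‖R 0 g‖ ^ 2 ≤ u ∧
      projDigit n (fun i => R (i + 1)) (l + ‖R 0 g‖ ^ 2) (g - R 0 g) u)

theorem measurableSet_projDigit (n : ℕ) (R : ℕ → H →L[ℝ] H) (l : ℝ) (g : H) :
    MeasurableSet {u | projDigit n R l g u} := by
  induction n generalizing R l g with
  | zero => exact measurableSet_Iio
  | succ n ih =>
    exact (measurableSet_Iio.inter (ih _ _ _)).union (measurableSet_Ici.inter (ih _ _ _))

open Classical in
/-- The product of the `R i`, `i < n`, `i ∈ J`. -/
noncomputable def projProd : ℕ → Set ℕ → (ℕ → H →L[ℝ] H) → H →L[ℝ] H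
  | 0, _, _ => ContinuousLinearMap.id ℝ H
  | n + 1, J, R =>
    if 0 ∈ J then (projProd n {i | i + 1 ∈ J} fun i => R (i + 1)).comp (R 0)
    else projProd n {i | i + 1 ∈ J} fun i => R (i + 1)

theorem projProd_comm (n : ℕ) (J : Set ℕ) (R : ℕ → H →L[ℝ] H) (S : H →L[ℝ] H)
    (hS : ∀ i x, S (R i x) = R i (S x)) (x : H) :
    projProd n J R (S x) = S (projProd n J R x) := by
  induction n generalizing R J x with
  | zero => rfl
  | succ n ih =>
    rw [projProd]
    split_ifs
    · simp only [ContinuousLinearMap.comp_apply]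
      rw [← hS, ih _ _ fun i => hS (i + 1)]
    · exact ih _ _ (fun i => hS (i + 1)) x

-- Cut the interval at `l + ‖R 0 g‖²`: by Pythagoras the two pieces have the lengths needed to
-- continue with `R 0 g` and `g - R 0 g`. If `0 ∈ J` only the left piece survives; otherwise both
-- do, and since the remaining product commutes with `R 0` their contributions add up by Pythagoras
-- again.
open Classical in
theorem volume_projDigit (n : ℕ) (J : Set ℕ) (R : ℕ → H →L[ℝ] H)
    (hcomm : ∀ i j x, R i (R j x) = R j (R i x))
    (hpyth : ∀ i x, ‖x‖ ^ 2 = ‖R i x‖ ^ 2 + ‖x - R i x‖ ^ 2) (l : ℝ) (g : H) :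
    volume (Ico l (l + ‖g‖ ^ 2) ∩ {u | ∀ i < n, i ∈ J → projDigit i R l g u})
      = ENNReal.ofReal (‖projProd n J R g‖ ^ 2) := by
  induction n generalizing R J l g with
  | zero => simp [projProd]
  | succ n ih =>
    have hc' : ∀ i j x, R (i + 1) (R (j + 1) x) = R (j + 1) (R (i + 1) x) :=
      fun i j => hcomm _ _
    have hp' : ∀ i x, ‖x‖ ^ 2 = ‖R (i + 1) x‖ ^ 2 + ‖x - R (i + 1) x‖ ^ 2 := fun i => hpyth _
    have hg := hpyth 0 g
    have i1 := ih {i | i + 1 ∈ J} (fun i => R (i + 1)) hc' hp' l (R 0 g)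
    have i2 := ih {i | i + 1 ∈ J} (fun i => R (i + 1)) hc' hp' (l + ‖R 0 g‖ ^ 2) (g - R 0 g)
    have e1 : Ico l (l + ‖g‖ ^ 2) ∩ {u | ∀ i < n + 1, i ∈ J → projDigit i R l g u} ∩
          Iio (l + ‖R 0 g‖ ^ 2)
        = Ico l (l + ‖R 0 g‖ ^ 2) ∩ {u | ∀ i < n, i ∈ {i | i + 1 ∈ J} →
            projDigit i (fun i => R (i + 1)) l (R 0 g) u} := by
      ext u
      constructor
      · rintro ⟨⟨⟨h1, h2⟩, h3⟩, h4⟩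
        refine ⟨⟨h1, h4⟩, fun i hi hiJ => ?_⟩
        rcases h3 (i + 1) (by omega) hiJ with h | h
        · exact h.2
        · exact absurd h4 (not_lt.2 h.1)
      · rintro ⟨⟨h1, h2⟩, h3⟩
        refine ⟨⟨⟨h1, h2.trans_le ?_⟩, fun i hi hiJ => ?_⟩, h2⟩
        · have := sq_nonneg ‖g - R 0 g‖
          linarith
        · cases i with
          | zero => exact h2
          | succ i => exact Or.inl ⟨h2, h3 i (by omega) hiJ⟩
    have e2 : (Ico l (l + ‖g‖ ^ 2) ∩ {u | ∀ i < n + 1, i ∈ J → projDigit i R l g u}) \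
          Iio (l + ‖R 0 g‖ ^ 2)
        = if 0 ∈ J then ∅ else Ico (l + ‖R 0 g‖ ^ 2) (l + ‖R 0 g‖ ^ 2 + ‖g - R 0 g‖ ^ 2) ∩
            {u | ∀ i < n, i ∈ {i | i + 1 ∈ J} →
            projDigit i (fun i => R (i + 1)) (l + ‖R 0 g‖ ^ 2) (g - R 0 g) u} := by
      split_ifs with h0
      · rw [eq_empty_iff_forall_notMem]
        rintro u ⟨⟨-, h3⟩, h4⟩
        exact h4 (h3 0 (by omega) h0)
      · ext u
        constructor
        · rintro ⟨⟨⟨h1, h2⟩, h3⟩, h4⟩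
          have h4 : l + ‖R 0 g‖ ^ 2 ≤ u := not_lt.1 h4
          refine ⟨⟨h4, by linarith⟩, fun i hi hiJ => ?_⟩
          rcases h3 (i + 1) (by omega) hiJ with h | h
          · exact absurd h4 (not_le.2 h.1)
          · exact h.2
        · rintro ⟨⟨h1, h2⟩, h3⟩
          refine ⟨⟨⟨le_trans ?_ h1, by linarith⟩, fun i hi hiJ => ?_⟩, not_lt.2 h1⟩
          · have := sq_nonneg ‖R 0 g‖
            linarith
          · cases i with
            | zero => exact absurd hiJ h0
            | succ i => exact Or.inr ⟨h1, h3 i (by omega) hiJ⟩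
    rw [← measure_inter_add_sdiff _ (measurableSet_Iio (a := l + ‖R 0 g‖ ^ 2)), e1, e2, i1]
    rw [projProd]
    split_ifs with h0
    · simp
    · rw [i2, ← ENNReal.ofReal_add (by positivity) (by positivity), map_sub,
        projProd_comm _ _ _ _ (fun i x => hcomm _ _ _), ← hpyth]

/-- The enumeration `e` may repeat an index; this is harmless because `hins` absorbs repeated
factors. -/
theorem projProd_eq_of_mem {ι : Type*} (Z : Finset ι → H →L[ℝ] H) [DecidableEq ι] (n : ℕ)
    (J : Set ℕ) (e : ℕ → ι) (h0 : ∀ x, Z ∅ x = x)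
    (hins : ∀ i s x, Z (insert i s) x = Z s (Z {i} x)) (x : H) [DecidablePred (· ∈ J)] :
    projProd n J (fun i => Z {e i}) x = Z (((Finset.range n).filter (· ∈ J)).image e) x := by
  induction n generalizing J e x with
  | zero => simp [projProd, h0]
  | succ n ih =>
    have hdec : DecidablePred (· ∈ {i | i + 1 ∈ J}) := fun i => inferInstanceAs (Decidable (i + 1 ∈ J))
    have key := fun y => ih {i | i + 1 ∈ J} (fun i => e (i + 1)) y
    rw [projProd]
    split_ifs with h
    · rw [ContinuousLinearMap.comp_apply, key, ← hins]
      congr 2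
      ext i
      simp only [Finset.mem_insert, Finset.mem_image, Finset.mem_filter, Finset.mem_range,
        mem_ofPred_eq]
      constructor
      · rintro (rfl | ⟨a, ⟨h1, h2⟩, rfl⟩)
        · exact ⟨0, ⟨by omega, h⟩, rfl⟩
        · exact ⟨a + 1, ⟨by omega, h2⟩, rfl⟩
      · rintro ⟨a, ⟨h1, h2⟩, rfl⟩
        cases a with
        | zero => exact Or.inl rfl
        | succ a => exact Or.inr ⟨a, ⟨by omega, h2⟩, rfl⟩
    · rw [key]
      congr 2
      ext i
      simp only [Finset.mem_image, Finset.mem_filter, Finset.mem_range, mem_ofPred_eq]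
      constructor
      · rintro ⟨a, ⟨h1, h2⟩, rfl⟩
        exact ⟨a + 1, ⟨by omega, h2⟩, rfl⟩
      · rintro ⟨a, ⟨h1, h2⟩, rfl⟩
        cases a with
        | zero => exact absurd h2 h
        | succ a => exact ⟨a, ⟨by omega, h2⟩, rfl⟩

/-- A vector and a countable family of commuting projections (indexed together with their finite
products) are modelled by events in a finite measure space. -/
theorem exists_events {ι : Type*} [Countable ι] [Nonempty ι] [DecidableEq ι]
    (Z : Finset ι → H →L[ℝ] H)
    (h0 : ∀ x, Z ∅ x = x) (hins : ∀ i s x, Z (insert i s) x = Z s (Z {i} x))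
    (hpyth : ∀ s x, ‖x‖ ^ 2 = ‖Z s x‖ ^ 2 + ‖x - Z s x‖ ^ 2) (f : H) :
    ∃ (μ : Measure ℝ) (A : ι → Set ℝ), (∀ i, MeasurableSet (A i)) ∧
      ∀ s : Finset ι, μ (⋂ i ∈ s, A i) = ENNReal.ofReal (‖Z s f‖ ^ 2) := by
  classical
  obtain ⟨e, he⟩ := exists_surjective_nat ι
  have hcomm : ∀ i j x, Z {i} (Z {j} x) = Z {j} (Z {i} x) := by
    intro i j x
    rw [← hins, ← hins, Finset.pair_comm]
  obtain ⟨k, hk⟩ := he.hasRightInverse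
  -- Lebesgue measure on an interval of length `‖f‖²`. The right inverse `k` selects one digit
  -- position for each index.
  refine ⟨volume.restrict (Ico 0 (0 + ‖f‖ ^ 2)),
    fun i => {u | projDigit (k i) (fun i => Z {e i}) 0 f u},
    fun i => measurableSet_projDigit _ _ _ _, fun s => ?_⟩
  have hJ : ∃ n, ∀ i ∈ s, k i < n := by
    refine ⟨s.sup k + 1, fun i hi => Nat.lt_succ_of_le (Finset.le_sup (f := k) hi)⟩
  obtain ⟨n, hn⟩ := hJ
  have h1 := volume_projDigit n (k '' s) (fun i => Z {e i}) (fun i j => hcomm _ _)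
    (fun i => hpyth _) 0 f
  rw [projProd_eq_of_mem Z n _ e h0 hins] at h1
  have h2 : ((Finset.range n).filter (· ∈ k '' (s : Set ι))).image e = s := by
    ext i
    simp only [Finset.mem_image, Finset.mem_filter, Finset.mem_range, Set.mem_image,
      Finset.mem_coe]
    constructor
    · rintro ⟨_, ⟨-, j, hj, rfl⟩, rfl⟩
      rwa [hk]
    · intro hi
      exact ⟨k i, ⟨hn i hi, i, hi, rfl⟩, hk i⟩
  rw [h2] at h1
  rw [← h1, Measure.restrict_apply, inter_comm]
  · congr 1
    ext u
    simp only [mem_inter_iff, mem_iInter, mem_ofPred_eq]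
    refine and_congr_right fun _ => ⟨?_, fun h i hi => h _ (hn i hi) ⟨i, hi, rfl⟩⟩
    rintro h _ - ⟨j, hj, rfl⟩
    exact h j hj
  · exact Finset.measurableSet_biInter s fun i _ => measurableSet_projDigit _ _ _ _

end Events

/-! ### From an avoidance family to a random compact set. -/

section Avoidance
open Filter Topology Set
open scoped ENNReal

/-- A family of commuting projections `Z E`, for Borel sets `E ⊆ ℝ`, to be thought of as
the events that a random set avoids `E`. -/
structure IsAvoidanceFamily {H : Type*} [NormedAddCommGroup H] [InnerProductSpace ℝ H]
    (Z : Set ℝ → H →L[ℝ] H) : Prop where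
  empty : ∀ x, Z ∅ x = x
  union : ∀ E F, MeasurableSet E → MeasurableSet F → ∀ x, Z (E ∪ F) x = Z E (Z F x)
  pythagoras : ∀ E, MeasurableSet E → ∀ x, ‖x‖ ^ 2 = ‖Z E x‖ ^ 2 + ‖x - Z E x‖ ^ 2
  tendsto : ∀ E : ℕ → Set ℝ, (∀ n, MeasurableSet (E n)) → Antitone E → ⋂ n, E n = ∅ →
    ∀ x, Tendsto (fun n => Z (E n) x) atTop (𝓝 x)
  singleton : ∀ a x, Z {a} x = x

namespace IsAvoidanceFamily

variable {H : Type*} [NormedAddCommGroup H] [InnerProductSpace ℝ H]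
  {Z : Set ℝ → H →L[ℝ] H}

theorem norm_le (hZ : IsAvoidanceFamily Z) {E : Set ℝ} (hE : MeasurableSet E) (x : H) :
    ‖Z E x‖ ≤ ‖x‖ := by
  have := hZ.pythagoras E hE x
  exact le_of_sq_le_sq (by nlinarith [sq_nonneg ‖x - Z E x‖]) (norm_nonneg _)

theorem norm_anti (hZ : IsAvoidanceFamily Z) {E F : Set ℝ} (hE : MeasurableSet E)
    (hF : MeasurableSet F) (h : E ⊆ F) (x : H) : ‖Z F x‖ ≤ ‖Z E x‖ := by
  rw [← union_eq_self_of_subset_right h, hZ.union F E hF hE]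
  exact hZ.norm_le hF _

/-- The missing part `(⋃ E n) \ E n` decreases to `∅`, and `Z (⋃ E n)` factors through it followed
by the contraction `Z (E n)`. -/
theorem tendsto_iUnion (hZ : IsAvoidanceFamily Z) {E : ℕ → Set ℝ} (hE : ∀ n, MeasurableSet (E n))
    (hmono : Monotone E) (x : H) :
    Tendsto (fun n => Z (E n) x) atTop (𝓝 (Z (⋃ n, E n) x)) := by
  have hU : MeasurableSet (⋃ n, E n) := MeasurableSet.iUnion hE
  have h := hZ.tendsto (fun n => (⋃ n, E n) \ E n) (fun n => hU.diff (hE n))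
    (fun i j hij => sdiff_subset_sdiff_right (hmono hij)) (by
      rw [← sdiff_iUnion, sdiff_self]) x
  have h1 : Tendsto (fun n => x - Z ((⋃ n, E n) \ E n) x) atTop (𝓝 0) := by
    simpa using (tendsto_const_nhds (x := x)).sub h
  rw [tendsto_iff_norm_sub_tendsto_zero]
  refine squeeze_zero (fun _ => norm_nonneg _) (fun n => ?_) (by simpa using h1.norm)
  have h2 : Z (⋃ n, E n) x = Z (E n) (Z ((⋃ n, E n) \ E n) x) := by
    rw [← hZ.union _ _ (hE n) (hU.diff (hE n)), union_sdiff_cancel (subset_iUnion E n)]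
  rw [h2, ← map_sub]
  exact hZ.norm_le (hE n) _

/-- The excess `E n \ ⋂ E n` decreases to `∅`; apply continuity there to the vector `Z (⋂ E n) x`.
-/
theorem tendsto_iInter (hZ : IsAvoidanceFamily Z) {E : ℕ → Set ℝ} (hE : ∀ n, MeasurableSet (E n))
    (hanti : Antitone E) (x : H) :
    Tendsto (fun n => Z (E n) x) atTop (𝓝 (Z (⋂ n, E n) x)) := by
  have hI : MeasurableSet (⋂ n, E n) := MeasurableSet.iInter hE
  have h := hZ.tendsto (fun n => E n \ ⋂ n, E n) (fun n => (hE n).diff hI)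
    (fun i j hij => sdiff_subset_sdiff_left (hanti hij)) (by
      ext y
      simp only [mem_iInter, Set.mem_sdiff, mem_empty_iff_false, iff_false]
      exact fun hy => (hy 0).2 fun n => (hy n).1) (Z (⋂ n, E n) x)
  refine h.congr fun n => ?_
  rw [← hZ.union _ _ ((hE n).diff hI) hI, sdiff_union_of_subset (iInter_subset E n)]

theorem finite (hZ : IsAvoidanceFamily Z) {F : Set ℝ} (hF : F.Finite) (x : H) : Z F x = x := by
  induction F, hF using Set.Finite.induction_on with
  | empty => exact hZ.empty x
  | @insert a s _ hs ih =>
    rw [insert_eq, hZ.union _ _ (measurableSet_singleton a) hs.measurableSet, ih, hZ.singleton]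

/-- Test sets used to define the random set: rational intervals and complements of large
intervals. -/
def testSet : (ℚ × ℚ) ⊕ ℕ → Set ℝ
  | Sum.inl p => Ioo (p.1 : ℝ) p.2
  | Sum.inr n => (Icc (-(n : ℝ)) n)ᶜ

theorem measurableSet_testSet (i : (ℚ × ℚ) ⊕ ℕ) : MeasurableSet (testSet i) := by
  cases i with
  | inl p => exact measurableSet_Ioo
  | inr n => exact measurableSet_Icc.compl

theorem isOpen_testSet (i : (ℚ × ℚ) ⊕ ℕ) : IsOpen (testSet i) := by
  cases i with
  | inl p => exact isOpen_Ioo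
  | inr n => exact isClosed_Icc.isOpen_compl

theorem exists_rat_Icc_subset {U : Set ℝ} (hU : IsOpen U) {x : ℝ} (hx : x ∈ U) :
    ∃ a b : ℚ, x ∈ Ioo (a : ℝ) b ∧ Icc (a : ℝ) b ⊆ U := by
  obtain ⟨ε, hε, hb⟩ := Metric.isOpen_iff.1 hU x hx
  obtain ⟨a, ha1, ha2⟩ := exists_rat_btwn (show x - ε < x by linarith)
  obtain ⟨b, hb1, hb2⟩ := exists_rat_btwn (show x < x + ε by linarith)
  refine ⟨a, b, ⟨ha2, hb1⟩, fun y hy => hb ?_⟩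
  rw [Metric.mem_ball, Real.dist_eq, abs_lt]
  constructor <;> linarith [hy.1, hy.2]

section Model

variable {f : H} {μ : Measure ℝ} {A : (ℚ × ℚ) ⊕ ℕ → Set ℝ}

theorem measure_biInter (hZ : IsAvoidanceFamily Z) (hA : ∀ i, MeasurableSet (A i))
    (hμ : ∀ s : Finset ((ℚ × ℚ) ⊕ ℕ), μ (⋂ i ∈ s, A i)
      = ENNReal.ofReal (‖Z (⋃ i ∈ s, testSet i) f‖ ^ 2)) (T : Set ((ℚ × ℚ) ⊕ ℕ)) :
    μ (⋂ i ∈ T, A i) = ENNReal.ofReal (‖Z (⋃ i ∈ T, testSet i) f‖ ^ 2) := by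
  classical
  obtain ⟨e, he⟩ := exists_surjective_nat ((ℚ × ℚ) ⊕ ℕ)
  let s : ℕ → Finset ((ℚ × ℚ) ⊕ ℕ) := fun n => ((Finset.range n).image e).filter (· ∈ T)
  have hs : Monotone s := fun i j hij =>
    Finset.filter_subset_filter _ (Finset.image_subset_image (Finset.range_mono hij))
  have hT : ∀ i, i ∈ T ↔ ∃ n, i ∈ s n := by
    intro i
    simp only [s, Finset.mem_filter, Finset.mem_image, Finset.mem_range]
    constructor
    · intro hi
      obtain ⟨k, rfl⟩ := he i
      exact ⟨k + 1, ⟨k, by omega, rfl⟩, hi⟩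
    · rintro ⟨n, -, hi⟩
      exact hi
  have h1 : ⋂ i ∈ T, A i = ⋂ n, ⋂ i ∈ s n, A i := by
    ext u
    simp only [mem_iInter]
    exact ⟨fun h n i hi => h i ((hT i).2 ⟨n, hi⟩), fun h i hi => by
      obtain ⟨n, hn⟩ := (hT i).1 hi
      exact h n i hn⟩
  have h2 : ⋃ i ∈ T, testSet i = ⋃ n, ⋃ i ∈ s n, testSet i := by
    ext u
    simp only [mem_iUnion]
    exact ⟨fun ⟨i, hi, h⟩ => by
      obtain ⟨n, hn⟩ := (hT i).1 hi
      exact ⟨n, i, hn, h⟩, fun ⟨n, i, hi, h⟩ => ⟨i, (hT i).2 ⟨n, hi⟩, h⟩⟩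
  have t1 : Tendsto (fun n => μ (⋂ i ∈ s n, A i)) atTop (𝓝 (μ (⋂ i ∈ T, A i))) := by
    rw [h1]
    refine tendsto_measure_iInter_atTop
      (fun n => ((s n).measurableSet_biInter fun i _ => hA i).nullMeasurableSet)
      (fun i j hij => biInter_subset_biInter_left (hs hij)) ⟨0, ?_⟩
    rw [hμ]
    exact ENNReal.ofReal_ne_top
  have t2 := hZ.tendsto_iUnion
    (fun n => (s n).measurableSet_biUnion fun i _ => measurableSet_testSet i)
    (fun i j hij => biUnion_subset_biUnion_left (hs hij)) f
  rw [← h2] at t2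
  refine tendsto_nhds_unique t1 ?_
  simp only [hμ]
  exact ENNReal.tendsto_ofReal (t2.norm.pow 2)

/-- The sample points at which the events `A i` are consistent with a compact random set. -/
def goodSet (A : (ℚ × ℚ) ⊕ ℕ → Set ℝ) : Set ℝ :=
  (⋂ (s : Finset ((ℚ × ℚ) ⊕ ℕ)) (i : (ℚ × ℚ) ⊕ ℕ) (_ : testSet i ⊆ ⋃ j ∈ s, testSet j),
    ((⋂ j ∈ s, A j) \ A i)ᶜ) ∩ ⋃ n : ℕ, A (Sum.inr n)

theorem measurableSet_goodSet (hA : ∀ i, MeasurableSet (A i)) : MeasurableSet (goodSet A) := by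
  refine MeasurableSet.inter ?_ (MeasurableSet.iUnion fun n => hA _)
  exact MeasurableSet.iInter fun s => MeasurableSet.iInter fun i => MeasurableSet.iInter fun _ =>
    ((s.measurableSet_biInter fun j _ => hA j).diff (hA i)).compl

/-- If finitely many test sets cover `testSet i`, adding `i` does not change their union, hence not
the mass of the intersection of events. Boundedness is almost sure because the complements of large
intervals decrease to `∅`. -/
theorem measure_compl_goodSet (hZ : IsAvoidanceFamily Z) (hA : ∀ i, MeasurableSet (A i))
    (hμ : ∀ s : Finset ((ℚ × ℚ) ⊕ ℕ), μ (⋂ i ∈ s, A i)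
      = ENNReal.ofReal (‖Z (⋃ i ∈ s, testSet i) f‖ ^ 2)) : μ (goodSet A)ᶜ = 0 := by
  classical
  have huniv : μ univ = ENNReal.ofReal (‖f‖ ^ 2) := by
    simpa [hZ.empty] using hμ ∅
  have hfin : ∀ s, μ s ≠ ∞ := fun s =>
    ((measure_mono (subset_univ s)).trans_lt (by rw [huniv]; exact ENNReal.ofReal_lt_top)).ne
  rw [goodSet, compl_inter, measure_union_null_iff]
  constructor
  · simp only [compl_iInter, compl_compl, measure_iUnion_null_iff]
    intro s i hi
    have hm : MeasurableSet (⋂ j ∈ s, A j) := s.measurableSet_biInter fun j _ => hA j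
    have h1 := hμ (insert i s)
    rw [Finset.set_biUnion_insert, union_eq_self_of_subset_left hi, ← hμ s,
      Finset.set_biInter_insert] at h1
    have h2 := measure_inter_add_sdiff (μ := μ) (⋂ j ∈ s, A j) (hA i)
    rw [inter_comm, h1] at h2
    exact (ENNReal.add_right_inj (hfin (⋂ j ∈ s, A j))).1 (h2.trans (add_zero _).symm)
  · rw [compl_iUnion]
    have h3 : ∀ n : ℕ, μ (A (Sum.inr n))ᶜ
        = ENNReal.ofReal (‖f‖ ^ 2) - ENNReal.ofReal (‖Z (testSet (Sum.inr n)) f‖ ^ 2) := by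
      intro n
      rw [measure_compl (hA _) (hfin _), huniv]
      congr 1
      simpa using hμ {Sum.inr n}
    have h4 : Tendsto (fun n : ℕ => μ (A (Sum.inr n))ᶜ) atTop (𝓝 0) := by
      simp only [h3]
      have h5 := hZ.tendsto (fun n : ℕ => testSet (Sum.inr n)) (fun n => measurableSet_testSet _)
        (fun i j hij => compl_subset_compl.2 (Icc_subset_Icc
          (by simpa using hij) (by simpa using hij))) (by
          rw [eq_empty_iff_forall_notMem]
          intro x hx
          obtain ⟨n, hn⟩ := exists_nat_ge |x|
          exact (mem_iInter.1 hx n) (abs_le.1 hn)) f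
      have h6 := ENNReal.Tendsto.sub (tendsto_const_nhds (x := ENNReal.ofReal (‖f‖ ^ 2)))
        (ENNReal.tendsto_ofReal (h5.norm.pow 2)) (Or.inl ENNReal.ofReal_ne_top)
      simpa using h6
    exact le_antisymm (ge_of_tendsto' h4 fun n => measure_mono (iInter_subset _ n)) bot_le

/-- The random set determined by the avoidance events. -/
def rawSet (A : (ℚ × ℚ) ⊕ ℕ → Set ℝ) (u : ℝ) : Set ℝ :=
  {x | ∀ p : ℚ × ℚ, x ∈ Ioo (p.1 : ℝ) p.2 → u ∉ A (Sum.inl p)}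

theorem isClosed_rawSet (u : ℝ) : IsClosed (rawSet A u) := by
  have : rawSet A u = ⋂ (p : ℚ × ℚ) (_ : u ∈ A (Sum.inl p)), (Ioo (p.1 : ℝ) p.2)ᶜ := by
    ext x
    simp only [rawSet, mem_ofPred_eq, mem_iInter, mem_compl_iff]
    exact forall_congr' fun p => ⟨fun h h1 h2 => h h2 h1, fun h h1 h2 => h h2 h1⟩
  rw [this]
  exact isClosed_iInter fun p => isClosed_iInter fun _ => isOpen_Ioo.isClosed_compl

theorem mem_of_mem_goodSet {u : ℝ} (hu : u ∈ goodSet A) (s : Finset ((ℚ × ℚ) ⊕ ℕ))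
    (i : (ℚ × ℚ) ⊕ ℕ) (hi : testSet i ⊆ ⋃ j ∈ s, testSet j) (h : ∀ j ∈ s, u ∈ A j) :
    u ∈ A i := by
  by_contra hn
  have := mem_iInter.1 (mem_iInter.1 (mem_iInter.1 hu.1 s) i) hi
  exact this ⟨mem_iInter₂.2 h, hn⟩

theorem isCompact_rawSet {u : ℝ} (hu : u ∈ goodSet A) : IsCompact (rawSet A u) := by
  obtain ⟨n, hn⟩ := mem_iUnion.1 hu.2
  refine IsCompact.of_isClosed_subset (isCompact_Icc (a := -(n : ℝ)) (b := n))
    (isClosed_rawSet u) fun x hx => ?_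
  by_contra hxn
  obtain ⟨a, b, hab, hsub⟩ := exists_rat_Icc_subset (isOpen_testSet (Sum.inr n)) hxn
  refine hx (a, b) hab (mem_of_mem_goodSet hu {Sum.inr n} _ ?_ (by simpa using hn))
  simpa using! Ioo_subset_Icc_self.trans hsub

/-- If the raw set misses `U`, a closed rational interval inside `U` is covered by finitely many
avoided intervals, and consistency makes it avoided too. Closed intervals in the index set are what
allows this compactness argument. -/
theorem rawSet_inter_nonempty_iff {u : ℝ} (hu : u ∈ goodSet A) {U : Set ℝ} (hU : IsOpen U) :
    ¬ (rawSet A u ∩ U).Nonempty ↔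
      ∀ i ∈ {i | ∃ p : ℚ × ℚ, Icc (p.1 : ℝ) p.2 ⊆ U ∧ i = Sum.inl p}, u ∈ A i := by
  classical
  constructor
  · rintro h _ ⟨p, hp, rfl⟩
    have hcov : ∀ x ∈ Icc (p.1 : ℝ) p.2, ∃ q : ℚ × ℚ, x ∈ Ioo (q.1 : ℝ) q.2 ∧ u ∈ A (Sum.inl q) := by
      intro x hx
      by_contra! hne
      exact h ⟨x, fun q hq => hne q hq, hp hx⟩
    obtain ⟨t, ht⟩ := isCompact_Icc.elim_finite_subcover
      (fun q : {q : ℚ × ℚ // u ∈ A (Sum.inl q)} => Ioo (q.1.1 : ℝ) q.1.2) (fun _ => isOpen_Ioo)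
      (fun x hx => by
        obtain ⟨q, hq, hqA⟩ := hcov x hx
        exact mem_iUnion.2 ⟨⟨q, hqA⟩, hq⟩)
    refine mem_of_mem_goodSet hu (t.image fun q => Sum.inl q.1) _ ?_ ?_
    · intro x hx
      obtain ⟨q, hq, hxq⟩ := mem_iUnion₂.1 (ht (Ioo_subset_Icc_self hx))
      exact mem_iUnion₂.2 ⟨Sum.inl q.1, Finset.mem_image_of_mem _ hq, hxq⟩
    · intro j hj
      obtain ⟨q, -, rfl⟩ := Finset.mem_image.1 hj
      exact q.2
  · rintro h ⟨x, hx, hxU⟩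
    obtain ⟨a, b, hab, hsub⟩ := exists_rat_Icc_subset hU hxU
    exact hx (a, b) hab (h _ ⟨(a, b), hsub, rfl⟩)

end Model

/-- Every vector has a spectral random compact set. -/
theorem exists_random_compact (hZ : IsAvoidanceFamily Z) (f : H) :
    ∃ (μ : Measure ℝ) (M : ℝ → Set ℝ), IsFiniteMeasure μ ∧ (∀ u, IsCompact (M u)) ∧
      (∀ U, IsOpen U → MeasurableSet {u | (M u ∩ U).Nonempty}) ∧
      ∀ U, IsOpen U → μ {u | ¬ (M u ∩ U).Nonempty} = ENNReal.ofReal (‖Z U f‖ ^ 2) := by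
  classical
  obtain ⟨μ, A, hA, hμ⟩ := exists_events
    (fun s : Finset ((ℚ × ℚ) ⊕ ℕ) => Z (⋃ i ∈ s, testSet i))
    (fun x => by simpa using hZ.empty x)
    (fun i s x => by
      rw [Finset.set_biUnion_insert, union_comm, hZ.union _ _
        (s.measurableSet_biUnion fun j _ => measurableSet_testSet j) (measurableSet_testSet i)]
      simp)
    (fun s x => hZ.pythagoras _ (s.measurableSet_biUnion fun j _ => measurableSet_testSet j) x) f
  have huniv : μ univ = ENNReal.ofReal (‖f‖ ^ 2) := by
    simpa [hZ.empty] using hμ ∅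
  have hg := measurableSet_goodSet hA
  have hg0 := hZ.measure_compl_goodSet hA hμ
  have hset : ∀ U, IsOpen U → {u | ((if u ∈ goodSet A then rawSet A u else ∅) ∩ U).Nonempty}
      = goodSet A \ ⋂ i ∈ {i | ∃ p : ℚ × ℚ, Icc (p.1 : ℝ) p.2 ⊆ U ∧ i = Sum.inl p}, A i := by
    intro U hU
    ext u
    by_cases hu : u ∈ goodSet A
    · have := rawSet_inter_nonempty_iff hu hU
      simp only [mem_ofPred_eq, hu, if_true, Set.mem_sdiff, true_and, mem_iInter]
      rw [← not_iff_not, this, not_not]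
      rfl
    · simp [hu]
  have hmeas : ∀ U, MeasurableSet
      (⋂ i ∈ {i | ∃ p : ℚ × ℚ, Icc (p.1 : ℝ) p.2 ⊆ U ∧ i = Sum.inl p}, A i) := fun U =>
    MeasurableSet.biInter (to_countable _) fun i _ => hA i
  refine ⟨μ, fun u => if u ∈ goodSet A then rawSet A u else ∅,
    ⟨by rw [huniv]; exact ENNReal.ofReal_lt_top⟩, fun u => ?_, fun U hU => ?_, fun U hU => ?_⟩
  · dsimp only
    split_ifs with hu
    · exact isCompact_rawSet hu
    · exact isCompact_empty
  · rw [hset U hU]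
    exact hg.diff (hmeas U)
  · have h1 : {u | ¬ ((if u ∈ goodSet A then rawSet A u else ∅) ∩ U).Nonempty}
        =ᵐ[μ] (⋂ i ∈ {i | ∃ p : ℚ × ℚ, Icc (p.1 : ℝ) p.2 ⊆ U ∧ i = Sum.inl p}, A i : Set ℝ) := by
      have h2 : {u | ¬ ((if u ∈ goodSet A then rawSet A u else ∅) ∩ U).Nonempty}
          = (goodSet A \ ⋂ i ∈ {i | ∃ p : ℚ × ℚ, Icc (p.1 : ℝ) p.2 ⊆ U ∧ i = Sum.inl p}, A i)ᶜ := by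
        rw [← hset U hU]
        rfl
      rw [h2]
      refine Filter.eventuallyEq_set.2 ?_
      have : ∀ᵐ u ∂μ, u ∈ goodSet A := by
        rw [ae_iff]
        exact hg0
      filter_upwards [this] with u hu
      simp only [mem_compl_iff, Set.mem_sdiff, hu, true_and, not_not]
    rw [measure_congr h1, hZ.measure_biInter hA hμ]
    congr 5
    ext x
    simp only [mem_iUnion, exists_prop, mem_ofPred_eq]
    constructor
    · rintro ⟨_, ⟨p, hp, rfl⟩, hx⟩
      exact hp (Ioo_subset_Icc_self hx)
    · intro hx
      obtain ⟨a, b, hab, hsub⟩ := exists_rat_Icc_subset hU hx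
      exact ⟨_, ⟨(a, b), hsub, rfl⟩, hab⟩

end IsAvoidanceFamily
end Avoidance

/-! ### Hitting capacity, leftmost points and a control measure. -/

section Spectrum
open Filter Topology Set
open scoped ENNReal

/-- `M` is a random compact set, defined on the measure space `(ℝ, μ)`, that avoids an open set `U`
with probability `‖Z U f‖²`. -/
structure IsRandomSpectrum {H : Type*} [NormedAddCommGroup H] [InnerProductSpace ℝ H]
    (Z : Set ℝ → H →L[ℝ] H) (f : H) (μ : Measure ℝ) (M : ℝ → Set ℝ) : Prop where
  isCompact : ∀ u, IsCompact (M u)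
  measurableSet_hit : ∀ U, IsOpen U → MeasurableSet {u | (M u ∩ U).Nonempty}
  measure_avoid : ∀ U, IsOpen U →
    μ {u | ¬ (M u ∩ U).Nonempty} = ENNReal.ofReal (‖Z U f‖ ^ 2)

/-- The hitting capacity of a vector. -/
noncomputable def hitCap {H : Type*} [NormedAddCommGroup H] [InnerProductSpace ℝ H]
    (Z : Set ℝ → H →L[ℝ] H) (f : H) (E : Set ℝ) : ℝ := ‖f‖ ^ 2 - ‖Z E f‖ ^ 2

/-- The leftmost point of `M ∩ (a, b)`, and `b` if there is none. -/
noncomputable def leftmost (M : ℝ → Set ℝ) (a b : ℝ) (u : ℝ) : ℝ := sInf (insert b (M u ∩ Ioi a))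

/-- The law of the leftmost point of `M ∩ (a, b)`. -/
noncomputable def leftLaw (μ : Measure ℝ) (M : ℝ → Set ℝ) (a b : ℝ) : Measure ℝ :=
  (μ.restrict {u | (M u ∩ Ioo a b).Nonempty}).map (leftmost M a b)

variable {H : Type*} [NormedAddCommGroup H] [InnerProductSpace ℝ H]
  {Z : Set ℝ → H →L[ℝ] H} {f : H} {μ : Measure ℝ} {M : ℝ → Set ℝ}

theorem hitCap_mono (hZ : IsAvoidanceFamily Z) {E F : Set ℝ} (hE : MeasurableSet E)
    (hF : MeasurableSet F) (h : E ⊆ F) : hitCap Z f E ≤ hitCap Z f F := by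
  have := hZ.norm_anti hE hF h f
  unfold hitCap
  have := pow_le_pow_left₀ (norm_nonneg _) this 2
  linarith

theorem hitCap_nonneg (hZ : IsAvoidanceFamily Z) {E : Set ℝ} (hE : MeasurableSet E) :
    0 ≤ hitCap Z f E := by
  have := pow_le_pow_left₀ (norm_nonneg _) (hZ.norm_le hE f) 2
  unfold hitCap
  linarith

theorem tendsto_hitCap_iInter (hZ : IsAvoidanceFamily Z) {E : ℕ → Set ℝ}
    (hE : ∀ n, MeasurableSet (E n)) (hanti : Antitone E) :
    Tendsto (fun n => hitCap Z f (E n)) atTop (𝓝 (hitCap Z f (⋂ n, E n))) :=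
  tendsto_const_nhds.sub ((hZ.tendsto_iInter hE hanti f).norm.pow 2)

namespace IsRandomSpectrum

theorem measure_univ_eq (hM : IsRandomSpectrum Z f μ M) (hZ : IsAvoidanceFamily Z) :
    μ univ = ENNReal.ofReal (‖f‖ ^ 2) := by
  have := hM.measure_avoid ∅ isOpen_empty
  simpa [hZ.empty] using this

theorem measure_hit (hM : IsRandomSpectrum Z f μ M) (hZ : IsAvoidanceFamily Z) {U : Set ℝ}
    (hU : IsOpen U) :
    μ {u | (M u ∩ U).Nonempty} = ENNReal.ofReal (hitCap Z f U) := by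
  have h1 : {u | (M u ∩ U).Nonempty} = {u | ¬ (M u ∩ U).Nonempty}ᶜ := by
    ext u; simp
  have h2 : MeasurableSet {u | ¬ (M u ∩ U).Nonempty} := (hM.measurableSet_hit U hU).compl
  rw [h1, measure_compl h2 (by rw [hM.measure_avoid U hU]; exact ENNReal.ofReal_ne_top),
    hM.measure_avoid U hU, hM.measure_univ_eq hZ, hitCap, ENNReal.ofReal_sub _ (by positivity)]

/-- Balls shrink to `{x}`, whose capacity is zero because `Z {x}` is the identity. -/
theorem measure_mem (hM : IsRandomSpectrum Z f μ M) (hZ : IsAvoidanceFamily Z) (x : ℝ) :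
    μ {u | x ∈ M u} = 0 := by
  have hlim := tendsto_hitCap_iInter (f := f) hZ
    (E := fun n : ℕ => Metric.ball x (1 / ((n : ℝ) + 1))) (fun n => measurableSet_ball)
    (fun i j hij => Metric.ball_subset_ball (one_div_le_one_div_of_le (by positivity) (by
      have : (i : ℝ) ≤ j := by exact_mod_cast hij
      linarith)))
  have h1 : ⋂ n : ℕ, Metric.ball x (1 / ((n : ℝ) + 1)) = {x} := by
    ext y
    simp only [mem_iInter, Metric.mem_ball, mem_singleton_iff]
    constructor
    · intro h
      have h2 : dist y x ≤ 0 :=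
        ge_of_tendsto' tendsto_one_div_add_atTop_nhds_zero_nat fun n => (h n).le
      exact dist_le_zero.1 h2
    · rintro rfl n
      rw [dist_self]
      positivity
  rw [h1] at hlim
  have h2 : hitCap Z f {x} = 0 := by simp [hitCap, hZ.singleton]
  rw [h2] at hlim
  have h3 := ENNReal.tendsto_ofReal hlim
  rw [ENNReal.ofReal_zero] at h3
  refine le_antisymm (ge_of_tendsto' h3 fun n => ?_) bot_le
  rw [← hM.measure_hit hZ Metric.isOpen_ball]
  exact measure_mono fun u hu => ⟨x, hu, Metric.mem_ball_self (by positivity)⟩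

theorem ae_notMem (hM : IsRandomSpectrum Z f μ M) (hZ : IsAvoidanceFamily Z) (x : ℝ) :
    ∀ᵐ u ∂μ, x ∉ M u := by
  rw [ae_iff]
  simpa using hM.measure_mem hZ x

theorem measurable_leftmost (hM : IsRandomSpectrum Z f μ M) (a b : ℝ) :
    Measurable (leftmost M a b) := by
  refine measurable_of_Iio fun t => ?_
  have : leftmost M a b ⁻¹' Iio t = {u | b < t} ∪ {u | (M u ∩ Ioo a t).Nonempty} := by
    ext u
    have hb : BddBelow (insert b (M u ∩ Ioi a)) :=
      bddBelow_insert.2 (bddBelow_Ioi.mono inter_subset_right)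
    simp only [mem_preimage, mem_Iio, mem_union, mem_ofPred_eq, leftmost,
      csInf_lt_iff hb (insert_nonempty _ _)]
    constructor
    · rintro ⟨y, rfl | ⟨h1, h2⟩, h3⟩
      · exact Or.inl h3
      · exact Or.inr ⟨y, h1, h2, h3⟩
    · rintro (h | ⟨y, h1, h2, h3⟩)
      · exact ⟨b, mem_insert _ _, h⟩
      · exact ⟨y, Or.inr ⟨h1, h2⟩, h3⟩
  rw [this]
  exact (MeasurableSet.const _).union (hM.measurableSet_hit _ isOpen_Ioo)

theorem leftmost_mem (hM : IsRandomSpectrum Z f μ M) {a b u : ℝ} (ha : a ∉ M u)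
    (h : (M u ∩ Ioo a b).Nonempty) : leftmost M a b u ∈ M u ∩ Ioo a b := by
  obtain ⟨z, hz, hza, hzb⟩ := h
  obtain ⟨y, ⟨hyM, hya, hyb⟩, hy⟩ :=
    ((hM.isCompact u).inter_right (isClosed_Icc (a := a) (b := b))).exists_isLeast
      ⟨z, hz, hza.le, hzb.le⟩
  have hay : a < y := lt_of_le_of_ne hya fun h => ha (h ▸ hyM)
  have hyz : y ≤ z := hy ⟨hz, hza.le, hzb.le⟩
  have : leftmost M a b u = y := by
    refine IsLeast.csInf_eq ⟨Or.inr ⟨hyM, hay⟩, ?_⟩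
    rintro w (rfl | ⟨hw, hwa⟩)
    · exact hyb
    · by_cases hwb : w ≤ b
      · exact hy ⟨hw, le_of_lt hwa, hwb⟩
      · exact hyb.trans (not_le.1 hwb).le
  rw [this]
  exact ⟨hyM, hay, hyz.trans_lt hzb⟩

theorem leftLaw_apply (hM : IsRandomSpectrum Z f μ M) {a b : ℝ} {B : Set ℝ}
    (hB : MeasurableSet B) :
    leftLaw μ M a b B = μ (leftmost M a b ⁻¹' B ∩ {u | (M u ∩ Ioo a b).Nonempty}) := by
  rw [leftLaw, Measure.map_apply (hM.measurable_leftmost a b) hB, Measure.restrict_apply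
    (hM.measurable_leftmost a b hB)]

theorem leftLaw_univ (hM : IsRandomSpectrum Z f μ M) (hZ : IsAvoidanceFamily Z) (a b : ℝ) :
    leftLaw μ M a b univ = ENNReal.ofReal (hitCap Z f (Ioo a b)) := by
  rw [hM.leftLaw_apply MeasurableSet.univ, preimage_univ, univ_inter, hM.measure_hit hZ isOpen_Ioo]

theorem leftLaw_Ioo (hM : IsRandomSpectrum Z f μ M) (hZ : IsAvoidanceFamily Z) (a b : ℝ) :
    leftLaw μ M a b (Ioo a b) = ENNReal.ofReal (hitCap Z f (Ioo a b)) := by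
  rw [hM.leftLaw_apply measurableSet_Ioo, ← hM.measure_hit hZ isOpen_Ioo]
  refine measure_congr (Filter.eventuallyEq_set.2 ?_)
  filter_upwards [hM.ae_notMem hZ a] with u hu
  exact ⟨fun h => h.2, fun h => ⟨(hM.leftmost_mem hu h).2, h⟩⟩

/-- The leftmost point is a point of `M`, so its law on a compact `K` is at most the capacity of
each thickening of `K`. Continuity from above of the capacity gives the bound for `K`, and inner
regularity of the law gives it for Borel sets, with no need to measure the event that `M` hits a
Borel set. -/
theorem leftLaw_le (hM : IsRandomSpectrum Z f μ M) (hZ : IsAvoidanceFamily Z) (a b : ℝ)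
    {B : Set ℝ} (hB : MeasurableSet B) : leftLaw μ M a b B ≤ ENNReal.ofReal (hitCap Z f B) := by
  have hfin : IsFiniteMeasure (leftLaw μ M a b) :=
    ⟨by rw [hM.leftLaw_univ hZ]; exact ENNReal.ofReal_lt_top⟩
  rw [hB.measure_eq_iSup_isCompact]
  refine iSup_le fun K => iSup_le fun hKB => iSup_le fun hK => ?_
  have hanti : Antitone fun n : ℕ => Metric.thickening (1 / ((n : ℝ) + 1)) K := fun i j hij =>
    Metric.thickening_mono (one_div_le_one_div_of_le (by positivity) (by
      have : (i : ℝ) ≤ j := by exact_mod_cast hij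
      linarith)) K
  have hlim := tendsto_hitCap_iInter (f := f) hZ
    (fun n => Metric.isOpen_thickening.measurableSet) hanti
  have h1 : ⋂ n : ℕ, Metric.thickening (1 / ((n : ℝ) + 1)) K = K := by
    refine Subset.antisymm (fun x hx => ?_) (subset_iInter fun n =>
      Metric.self_subset_thickening (by positivity) K)
    rw [← hK.isClosed.closure_eq, Metric.closure_eq_iInter_thickening]
    simp only [mem_iInter] at hx ⊢
    intro δ hδ
    obtain ⟨n, hn⟩ := exists_nat_one_div_lt hδ
    exact Metric.thickening_mono hn.le K (hx n)
  rw [h1] at hlim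
  refine le_trans (ge_of_tendsto' (ENNReal.tendsto_ofReal hlim) fun n => ?_)
    (ENNReal.ofReal_le_ofReal (hitCap_mono hZ hK.measurableSet hB hKB))
  rw [← hM.measure_hit hZ Metric.isOpen_thickening, hM.leftLaw_apply hK.measurableSet]
  refine measure_mono_ae ?_
  filter_upwards [hM.ae_notMem hZ a] with u hu
  rintro ⟨h2, h3⟩
  exact ⟨_, (hM.leftmost_mem hu h3).1, Metric.self_subset_thickening (by positivity) K h2⟩

/-- If `E` is negligible for the law of the leftmost point, then avoiding an interval outside `E`
amounts to avoiding it. -/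
theorem apply_Ioo_eq (hM : IsRandomSpectrum Z f μ M) (hZ : IsAvoidanceFamily Z) (a b : ℝ)
    {E : Set ℝ} (hE : MeasurableSet E) (h0 : leftLaw μ M a b E = 0) :
    Z (Ioo a b) f = Z (Ioo a b \ E) f := by
  have hm : MeasurableSet (Ioo a b \ E) := measurableSet_Ioo.diff hE
  -- As `E` is null, the leftmost point, when it exists, lies almost surely in `Ioo a b \ E`. The
  -- two capacities then agree, and equality in Pythagoras identifies the vectors.
  have h1 := hM.leftLaw_le hZ a b hm
  rw [measure_sdiff_null h0, hM.leftLaw_Ioo hZ,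
    ENNReal.ofReal_le_ofReal_iff (hitCap_nonneg hZ hm)] at h1
  have h2 : Z (Ioo a b) f = Z (Ioo a b) (Z (Ioo a b \ E) f) := by
    rw [← hZ.union _ _ measurableSet_Ioo hm, union_eq_self_of_subset_right sdiff_subset]
  have h3 := hZ.pythagoras (Ioo a b) measurableSet_Ioo (Z (Ioo a b \ E) f)
  rw [← h2] at h3
  unfold hitCap at h1
  have h4 : ‖Z (Ioo a b \ E) f - Z (Ioo a b) f‖ ^ 2 ≤ 0 := by linarith
  have h5 : ‖Z (Ioo a b \ E) f - Z (Ioo a b) f‖ = 0 := by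
    have := sq_nonneg ‖Z (Ioo a b \ E) f - Z (Ioo a b) f‖
    exact pow_eq_zero_iff two_ne_zero |>.1 (le_antisymm h4 this)
  exact (sub_eq_zero.1 (norm_eq_zero.1 h5)).symm

/-- Exhaust `U` by finite unions of rational intervals. Commutation of the projections allows `E` to
be removed from one interval at a time. -/
theorem apply_isOpen_eq (hM : IsRandomSpectrum Z f μ M) (hZ : IsAvoidanceFamily Z)
    {E : Set ℝ} (hE : MeasurableSet E) (h0 : ∀ a b : ℚ, leftLaw μ M a b E = 0) {U : Set ℝ}
    (hU : IsOpen U) : Z U f = Z (U \ E) f := by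
  classical
  obtain ⟨e, he⟩ := exists_surjective_nat (ℚ × ℚ)
  let J : ℕ → Set ℝ := fun k => if Ioo ((e k).1 : ℝ) (e k).2 ⊆ U then Ioo ((e k).1 : ℝ) (e k).2 else ∅
  have hJo : ∀ k, IsOpen (J k) := by
    intro k
    simp only [J]
    split_ifs
    · exact isOpen_Ioo
    · exact isOpen_empty
  have hJZ : ∀ k, Z (J k) f = Z (J k \ E) f := by
    intro k
    simp only [J]
    split_ifs
    · exact hM.apply_Ioo_eq hZ _ _ hE (h0 _ _)
    · simp
  let W : ℕ → Set ℝ := fun n => ⋃ k < n, J k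
  have hWo : ∀ n, IsOpen (W n) := fun n => isOpen_biUnion fun k _ => hJo k
  have hWmono : Monotone W := fun i j hij =>
    biUnion_subset_biUnion_left fun k (hk : k < i) => lt_of_lt_of_le hk hij
  have hWU : ⋃ n, W n = U := by
    apply Subset.antisymm
    · refine iUnion_subset fun n => iUnion₂_subset fun k _ => ?_
      simp only [J]
      split_ifs with h
      · exact h
      · exact empty_subset _
    · intro x hx
      obtain ⟨a, b, hab, hsub⟩ := IsAvoidanceFamily.exists_rat_Icc_subset hU hx
      obtain ⟨k, hk⟩ := he (a, b)
      refine mem_iUnion.2 ⟨k + 1, mem_iUnion₂.2 ⟨k, Nat.lt_succ_self k, ?_⟩⟩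
      simp only [J, hk, if_pos (Ioo_subset_Icc_self.trans hsub)]
      exact hab
  have hWZ : ∀ n, Z (W n) f = Z (W n \ E) f := by
    intro n
    induction n with
    | zero => simp [W]
    | succ n ih =>
      have h1 : W (n + 1) = W n ∪ J n := biUnion_lt_succ J n
      have m1 := (hWo n).measurableSet
      have m2 := (hJo n).measurableSet
      rw [h1, union_sdiff_distrib, hZ.union _ _ m1 m2, hJZ, ← hZ.union _ _ m1 (m2.diff hE),
        union_comm, hZ.union _ _ (m2.diff hE) m1, ih, ← hZ.union _ _ (m2.diff hE) (m1.diff hE),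
        union_comm]
  have t1 := hZ.tendsto_iUnion (fun n => (hWo n).measurableSet) hWmono f
  have t2 := hZ.tendsto_iUnion (E := fun n => W n \ E) (fun n => (hWo n).measurableSet.diff hE)
    (fun i j hij => sdiff_subset_sdiff_left (hWmono hij)) f
  rw [← iUnion_sdiff, hWU] at t2
  rw [hWU] at t1
  exact tendsto_nhds_unique t1 (t2.congr fun n => (hWZ n).symm)

/-- Deleting the negligible intersection from every `U n` changes no capacity, and the remaining
sets decrease to `∅`. -/
theorem tendsto_hitCap_zero (hM : IsRandomSpectrum Z f μ M) (hZ : IsAvoidanceFamily Z)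
    {U : ℕ → Set ℝ} (hU : ∀ n, IsOpen (U n)) (hanti : Antitone U)
    (h0 : ∀ a b : ℚ, leftLaw μ M a b (⋂ n, U n) = 0) :
    Tendsto (fun n => hitCap Z f (U n)) atTop (𝓝 0) := by
  have hE : MeasurableSet (⋂ n, U n) := MeasurableSet.iInter fun n => (hU n).measurableSet
  have h1 := tendsto_hitCap_iInter (f := f) hZ (E := fun n => U n \ ⋂ n, U n)
    (fun n => (hU n).measurableSet.diff hE)
    (fun i j hij => sdiff_subset_sdiff_left (hanti hij))
  have h2 : ⋂ n, (U n \ ⋂ n, U n) = ∅ := by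
    ext y
    simp only [mem_iInter, Set.mem_sdiff, mem_empty_iff_false, iff_false]
    exact fun hy => (hy 0).2 fun n => (hy n).1
  rw [h2] at h1
  have h3 : hitCap Z f ∅ = 0 := by simp [hitCap, hZ.empty]
  rw [h3] at h1
  refine h1.congr fun n => ?_
  unfold hitCap
  rw [← hM.apply_isOpen_eq hZ hE h0 (hU n)]

/-- A finite measure that controls the hitting capacity. -/
theorem exists_control (hM : IsRandomSpectrum Z f μ M) (hZ : IsAvoidanceFamily Z) :
    ∃ ν : Measure ℝ, IsFiniteMeasure ν ∧ ∀ ε > 0, ∃ δ : ℝ, 0 < δ ∧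
      ∀ U, IsOpen U → ν.real U < δ → hitCap Z f U ≤ ε := by
  obtain ⟨e, he⟩ := exists_surjective_nat (ℚ × ℚ)
  -- The geometric weights keep the mixture finite, and a `ν`-null set is null for every
  -- leftmost-point law with rational endpoints.
  let ν : Measure ℝ := Measure.sum fun n =>
    ((2 : ℝ≥0∞)⁻¹ ^ (n + 1)) • leftLaw μ M (e n).1 (e n).2
  have hν : IsFiniteMeasure ν := by
    constructor
    rw [Measure.sum_apply _ MeasurableSet.univ]
    have : ∀ n, (((2 : ℝ≥0∞)⁻¹ ^ (n + 1)) • leftLaw μ M (e n).1 (e n).2) univ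
        ≤ (2 : ℝ≥0∞)⁻¹ ^ (n + 1) * ENNReal.ofReal (‖f‖ ^ 2) := by
      intro n
      rw [Measure.smul_apply, smul_eq_mul, hM.leftLaw_univ hZ]
      gcongr
      unfold hitCap
      have := sq_nonneg ‖Z (Ioo ((e n).1 : ℝ) (e n).2) f‖
      linarith
    refine (ENNReal.tsum_le_tsum this).trans_lt ?_
    rw [ENNReal.tsum_mul_right, ENNReal.tsum_geometric_add_one]
    refine ENNReal.mul_lt_top (ENNReal.mul_lt_top (by simp) ?_) ENNReal.ofReal_lt_top
    rw [ENNReal.inv_lt_top]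
    simp
  have hν0 : ∀ E, ν E = 0 → ∀ a b : ℚ, leftLaw μ M a b E = 0 := by
    intro E hE a b
    rw [Measure.sum_apply_eq_zero] at hE
    obtain ⟨n, hn⟩ := he (a, b)
    have := hE n
    rw [hn, Measure.smul_apply, smul_eq_mul, mul_eq_zero] at this
    refine this.resolve_left (pow_ne_zero _ ?_)
    simp
  refine ⟨ν, hν, fun ε hε => ?_⟩
  -- Borel–Cantelli: otherwise there are open `U n` with `ν`-measure below `2⁻ⁿ` and capacity above
  -- `ε`. Their tail unions decrease to a `ν`-null set, so the capacities of the tails tend to zero.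
  by_contra! hcon
  choose U hUo hUν hUc using fun n : ℕ => hcon ((1 / 2 : ℝ) ^ n) (by positivity)
  have hsum : ∑' n, ν (U n) ≠ ∞ := by
    have h1 : ∀ n, ν (U n) ≤ ENNReal.ofReal ((1 / 2 : ℝ) ^ n) := fun n => by
      rw [← ofReal_measureReal]
      exact ENNReal.ofReal_le_ofReal (hUν n).le
    refine ne_top_of_le_ne_top ?_ (ENNReal.tsum_le_tsum h1)
    exact summable_geometric_two.tsum_ofReal_ne_top
  have hlimsup := measure_limsup_atTop_eq_zero hsum
  let W : ℕ → Set ℝ := fun n => ⋃ k ≥ n, U k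
  have hWo : ∀ n, IsOpen (W n) := fun n => isOpen_biUnion fun k _ => hUo k
  have hWanti : Antitone W := fun i j hij =>
    biUnion_subset_biUnion_left fun k (hk : j ≤ k) => le_trans hij hk
  have hWlim : limsup U atTop = ⋂ n, W n := by
    rw [limsup_eq_iInf_iSup_of_nat]
    rfl
  rw [hWlim] at hlimsup
  have hlim := hM.tendsto_hitCap_zero hZ hWo hWanti (hν0 _ hlimsup)
  have : ε ≤ 0 := ge_of_tendsto' hlim fun n => (hUc n).le.trans
    (hitCap_mono hZ (hUo n).measurableSet (hWo n).measurableSet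
      fun x hx => mem_iUnion₂.2 ⟨n, le_rfl, hx⟩)
  linarith

end IsRandomSpectrum
end Spectrum

/-! ### Weights of an independent random subset. -/

section RandomSubset
open Finset

/-- The probability that a random subset of `J`, in which every element is kept independently with
probability `p`, equals `S`. -/
noncomputable def subsetWeight {ι : Type*} [DecidableEq ι] (p : ℝ) (J S : Finset ι) : ℝ :=
  (∏ _i ∈ S, p) * ∏ _i ∈ J \ S, (1 - p)

variable {ι : Type*} [DecidableEq ι] {p : ℝ} {J : Finset ι}

theorem subsetWeight_nonneg (h0 : 0 ≤ p) (h1 : p ≤ 1) (S : Finset ι) : 0 ≤ subsetWeight p J S :=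
  mul_nonneg (prod_nonneg fun _ _ => h0) (prod_nonneg fun _ _ => sub_nonneg.2 h1)

theorem sum_subsetWeight : ∑ S ∈ J.powerset, subsetWeight p J S = 1 := by
  simp only [subsetWeight]
  rw [← prod_add]
  simp

/-- Expand a product over `J` in which the factor for omitting `j` is replaced by zero; this removes
exactly the subsets without `j`. -/
theorem sum_subsetWeight_mem {j : ι} (hj : j ∈ J) :
    ∑ S ∈ J.powerset, subsetWeight p J S * (if j ∈ S then 1 else 0) = p := by
  have h := prod_add (fun _ => p) (fun i => if i = j then 0 else 1 - p) J
  have h1 : ∏ i ∈ J, (p + if i = j then 0 else 1 - p) = p := by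
    rw [← mul_prod_erase J _ hj]
    simp only [if_true, add_zero]
    rw [prod_eq_one, mul_one]
    intro i hi
    rw [if_neg (ne_of_mem_erase hi)]
    ring
  rw [h1] at h
  refine Eq.trans (sum_congr rfl fun S hS => ?_) h.symm
  rw [subsetWeight, mul_assoc]
  congr 1
  split_ifs with hjS
  · rw [mul_one]
    refine prod_congr rfl fun i hi => ?_
    rw [if_neg]
    rintro rfl
    exact (mem_sdiff.1 hi).2 hjS
  · rw [mul_zero]
    exact (prod_eq_zero (f := fun i => if i = j then 0 else 1 - p) (mem_sdiff.2 ⟨hj, hjS⟩)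
      (if_pos rfl)).symm

theorem sum_subsetWeight_disjoint {T : Finset ι} (hT : T ⊆ J) :
    ∑ S ∈ J.powerset, subsetWeight p J S * (if Disjoint S T then 1 else 0) = (1 - p) ^ #T := by
  have h := prod_add (fun i => if i ∈ T then 0 else p) (fun _ => 1 - p) J
  have h1 : ∏ i ∈ J, ((if i ∈ T then 0 else p) + (1 - p)) = (1 - p) ^ #T := by
    rw [← prod_subset hT (f := fun i => (if i ∈ T then 0 else p) + (1 - p)), ← prod_const]
    · refine prod_congr rfl fun i hi => ?_
      rw [if_pos hi, zero_add]
    · intro i _ hi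
      rw [if_neg hi]
      ring
  rw [h1] at h
  rw [h]
  refine sum_congr rfl fun S hS => ?_
  rw [subsetWeight, mul_right_comm]
  congr 1
  split_ifs with hd
  · rw [mul_one]
    refine prod_congr rfl fun i hi => ?_
    rw [if_neg (disjoint_left.1 hd hi)]
  · rw [mul_zero]
    obtain ⟨i, hi, hiT⟩ := not_disjoint_iff.1 hd
    exact (prod_eq_zero (f := fun i => if i ∈ T then 0 else p) hi (if_pos hiT)).symm

end RandomSubset

/-! ### Almost sure finiteness of the random set by random thinning. -/

section Finiteness
open Filter Topology Set
open scoped ENNReal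

variable {H : Type*} [NormedAddCommGroup H] [InnerProductSpace ℝ H]
  {Z : Set ℝ → H →L[ℝ] H} {f : H} {μ : Measure ℝ} {M : ℝ → Set ℝ}

namespace IsRandomSpectrum

theorem isFiniteMeasure (hM : IsRandomSpectrum Z f μ M) (hZ : IsAvoidanceFamily Z) :
    IsFiniteMeasure μ :=
  ⟨by rw [hM.measure_univ_eq hZ]; exact ENNReal.ofReal_lt_top⟩

open Classical in
/-- The indices of the cells hit by the random set. -/
noncomputable def hitCells {ι : Type*} (M : ℝ → Set ℝ) (J : Finset ι) (I : ι → Set ℝ) (u : ℝ) :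
    Finset ι :=
  J.filter fun j => (M u ∩ I j).Nonempty

/-- With a probability close to one, the number of the cells hit by the random set is bounded
uniformly in the partition into cells. -/
theorem measureReal_hitCells_le {ι : Type*} [DecidableEq ι] (hM : IsRandomSpectrum Z f μ M)
    (hZ : IsAvoidanceFamily Z) {ε : ℝ} (hε : 0 < ε) :
    ∃ m : ℕ, ∀ (J : Finset ι) (I : ι → Set ℝ), (∀ j, IsOpen (I j)) →
      (J : Set ι).PairwiseDisjoint I →
      μ.real {u | m ≤ (hitCells M J I u).card} ≤ 3 * ε := by
  classical
  have hμ := hM.isFiniteMeasure hZ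
  obtain ⟨ν, hν, hctrl⟩ := hM.exists_control hZ
  obtain ⟨δ, hδ, hδU⟩ := hctrl ε hε
  set a := μ.real univ with ha
  set Λ := ν.real univ with hΛ
  have ha0 : 0 ≤ a := measureReal_nonneg
  have hΛ0 : 0 ≤ Λ := measureReal_nonneg
  obtain ⟨p, hp0, hp1, hp⟩ : ∃ p : ℝ, 0 < p ∧ p < 1 ∧ a / δ * (Λ * p) ≤ ε := by
    have hq : 0 ≤ a / δ * Λ := by positivity
    -- The second `ε` in the denominator keeps `p` strictly below one even when `a / δ * Λ`
    -- vanishes.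
    refine ⟨ε / (a / δ * Λ + ε + ε), by positivity, ?_, ?_⟩
    · rw [div_lt_one (by positivity)]
      linarith
    · rw [← mul_assoc, mul_div_assoc', div_le_iff₀ (by positivity)]
      nlinarith
  obtain ⟨m, hm⟩ : ∃ m : ℕ, (1 - p) ^ m * a ≤ ε := by
    have h1 := (tendsto_pow_atTop_nhds_zero_of_lt_one (r := 1 - p) (by linarith)
      (by linarith)).mul_const a
    rw [zero_mul] at h1
    exact (h1.eventually_le_const hε).exists
  refine ⟨m, fun J I hI hd => ?_⟩
  set B := {u | m ≤ (hitCells M J I u).card} with hB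
  let D : Finset ι → Set ℝ := fun S => ⋃ j ∈ S, I j
  have hDo : ∀ S, IsOpen (D S) := fun S => isOpen_biUnion fun j _ => hI j
  have hBm : MeasurableSet B := by
    have h1 : Measurable fun u => (hitCells M J I u).card := by
      simp only [hitCells, Finset.card_filter]
      exact Finset.measurable_sum _ fun j _ =>
        Measurable.ite (hM.measurableSet_hit _ (hI j)) measurable_const measurable_const
    exact h1 measurableSet_Ici
  let av : Finset ι → Set ℝ := fun S => {u | ¬ (M u ∩ D S).Nonempty}
  have hav : ∀ S, MeasurableSet (av S) := fun S => (hM.measurableSet_hit _ (hDo S)).compl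
  have havT : ∀ S ⊆ J, ∀ u, u ∈ av S ↔ Disjoint S (hitCells M J I u) := by
    intro S hS u
    rw [Finset.disjoint_left]
    constructor
    · intro h j hj hj'
      obtain ⟨x, hx, hxI⟩ := (Finset.mem_filter.1 hj').2
      exact h ⟨x, hx, mem_iUnion₂.2 ⟨j, hj, hxI⟩⟩
    · rintro h ⟨x, hx, hxD⟩
      obtain ⟨j, hj, hxI⟩ := mem_iUnion₂.1 hxD
      exact h hj (Finset.mem_filter.2 ⟨hS hj, x, hx, hxI⟩)
  -- the bound for a single choice of cells
  have hone : ∀ S ⊆ J, μ.real B ≤ μ.real (B ∩ av S) + ε + a / δ * ∑ j ∈ S, ν.real (I j) := by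
    intro S hS
    have hνS : ν.real (D S) ≤ ∑ j ∈ S, ν.real (I j) := measureReal_biUnion_finset_le _ _
    have h0 : 0 ≤ ∑ j ∈ S, ν.real (I j) := Finset.sum_nonneg fun _ _ => measureReal_nonneg
    by_cases hlt : ν.real (D S) < δ
    · have h1 := hδU _ (hDo S) hlt
      have h2 : μ.real {u | (M u ∩ D S).Nonempty} ≤ ε := by
        rw [measureReal_def, hM.measure_hit hZ (hDo S)]
        exact ENNReal.toReal_le_of_le_ofReal hε.le (ENNReal.ofReal_le_ofReal h1)
      have h3 : μ.real B ≤ μ.real (B ∩ av S) + μ.real {u | (M u ∩ D S).Nonempty} := by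
        refine (measureReal_mono (fun u hu => ?_)).trans (measureReal_union_le _ _)
        by_cases h : (M u ∩ D S).Nonempty
        · exact Or.inr h
        · exact Or.inl ⟨hu, h⟩
      have h4 : 0 ≤ a / δ * ∑ j ∈ S, ν.real (I j) := by positivity
      linarith
    · have h1 : μ.real B ≤ a := measureReal_mono (subset_univ _)
      have h2 : a ≤ a / δ * ∑ j ∈ S, ν.real (I j) := by
        rw [div_mul_eq_mul_div, le_div_iff₀ hδ]
        exact mul_le_mul_of_nonneg_left ((not_lt.1 hlt).trans hνS) ha0
      have h3 : 0 ≤ μ.real (B ∩ av S) := measureReal_nonneg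
      linarith
  have hw : ∀ S, 0 ≤ subsetWeight p J S := subsetWeight_nonneg hp0.le hp1.le
  -- On `B` at least `m` cells are hit, so the random family `S` misses all of them with probability
  -- at most `(1 - p) ^ m`.
  have hI1 : ∑ S ∈ J.powerset, subsetWeight p J S * μ.real (B ∩ av S) ≤ ε := by
    have h1 : ∀ S ∈ J.powerset, subsetWeight p J S * μ.real (B ∩ av S)
        = ∫ u, subsetWeight p J S * (B ∩ av S).indicator 1 u ∂μ := by
      intro S _
      rw [integral_const_mul, integral_indicator_one (hBm.inter (hav S))]
    have h1i : ∀ S ∈ J.powerset,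
        Integrable (fun u => subsetWeight p J S * (B ∩ av S).indicator (1 : ℝ → ℝ) u) μ := by
      intro S _
      exact ((integrable_const (1 : ℝ)).indicator (hBm.inter (hav S))).const_mul _
    rw [Finset.sum_congr rfl h1, ← integral_finsetSum _ h1i]
    refine le_trans ?_ hm
    have h2 : ∫ _u, (1 - p) ^ m ∂μ = (1 - p) ^ m * a := by
      simp [ha, mul_comm]
    rw [← h2]
    refine integral_mono (integrable_finsetSum _ h1i) (integrable_const _) fun u => ?_
    dsimp only
    by_cases hu : u ∈ B
    · have h3 : ∀ S ∈ J.powerset, subsetWeight p J S * (B ∩ av S).indicator (1 : ℝ → ℝ) u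
          = subsetWeight p J S * (if Disjoint S (hitCells M J I u) then 1 else 0) := by
        intro S hS
        congr 1
        have := havT S (Finset.mem_powerset.1 hS) u
        by_cases h : u ∈ av S
        · rw [indicator_of_mem (show u ∈ B ∩ av S from ⟨hu, h⟩), if_pos (this.1 h)]
          rfl
        · rw [indicator_of_notMem fun h' => h h'.2, if_neg fun h' => h (this.2 h')]
      rw [Finset.sum_congr rfl h3, sum_subsetWeight_disjoint (T := hitCells M J I u) (Finset.filter_subset _ _)]
      exact pow_le_pow_of_le_one (by linarith) (by linarith) hu
    · have h3 : ∀ S ∈ J.powerset, subsetWeight p J S * (B ∩ av S).indicator (1 : ℝ → ℝ) u = 0 := by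
        intro S _
        rw [indicator_of_notMem fun h' => hu h'.1, mul_zero]
      rw [Finset.sum_congr rfl h3, Finset.sum_const_zero]
      exact pow_nonneg (by linarith) _
  -- Each cell is kept with probability `p` and the cells are disjoint, so the expected total
  -- `ν`-measure of the kept cells is at most `Λ * p`. The factor `a / δ` is the Markov bound for
  -- exceeding `δ`.
  have hI2 : ∑ S ∈ J.powerset, subsetWeight p J S * (a / δ * ∑ j ∈ S, ν.real (I j)) ≤ ε := by
    have h1 : ∀ S ∈ J.powerset, subsetWeight p J S * (a / δ * ∑ j ∈ S, ν.real (I j))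
        = ∑ j ∈ J, a / δ * ν.real (I j) * (subsetWeight p J S * if j ∈ S then 1 else 0) := by
      intro S hS
      have h2 : ∑ j ∈ S, ν.real (I j) = ∑ j ∈ J, ν.real (I j) * if j ∈ S then 1 else 0 := by
        simp only [mul_ite, mul_one, mul_zero]
        rw [← Finset.sum_filter, Finset.filter_mem_eq_inter,
          Finset.inter_eq_right.2 (Finset.mem_powerset.1 hS)]
      rw [h2, Finset.mul_sum, Finset.mul_sum]
      exact Finset.sum_congr rfl fun j _ => by ring
    rw [Finset.sum_congr rfl h1, Finset.sum_comm]
    have h3 : ∀ j ∈ J, ∑ S ∈ J.powerset,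
        a / δ * ν.real (I j) * (subsetWeight p J S * if j ∈ S then 1 else 0)
        = a / δ * ν.real (I j) * p := by
      intro j hj
      rw [← Finset.mul_sum, sum_subsetWeight_mem hj]
    rw [Finset.sum_congr rfl h3, ← Finset.sum_mul, ← Finset.mul_sum,
      ← measureReal_biUnion_finset hd fun j _ => (hI j).measurableSet]
    refine le_trans ?_ hp
    rw [mul_assoc]
    have : ν.real (⋃ j ∈ J, I j) ≤ Λ := measureReal_mono (subset_univ _)
    gcongr
  calc μ.real B = ∑ S ∈ J.powerset, subsetWeight p J S * μ.real B := by
        rw [← Finset.sum_mul, sum_subsetWeight, one_mul]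
    _ ≤ ∑ S ∈ J.powerset, subsetWeight p J S *
          (μ.real (B ∩ av S) + ε + a / δ * ∑ j ∈ S, ν.real (I j)) :=
        Finset.sum_le_sum fun S hS =>
          mul_le_mul_of_nonneg_left (hone S (Finset.mem_powerset.1 hS)) (hw S)
    _ = ∑ S ∈ J.powerset, subsetWeight p J S * μ.real (B ∩ av S) + ε +
          ∑ S ∈ J.powerset, subsetWeight p J S * (a / δ * ∑ j ∈ S, ν.real (I j)) := by
        simp only [mul_add, Finset.sum_add_distrib]
        rw [← Finset.sum_mul _ _ ε, sum_subsetWeight, one_mul]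
    _ ≤ 3 * ε := by linarith

/-- The cells of the partition into intervals of length `1 / n`. -/
def gridCell (n : ℕ) (j : ℤ) : Set ℝ := Ioo ((j : ℝ) / n) ((j + 1 : ℝ) / n)

theorem mem_gridCell_floor {n : ℕ} (hn : 0 < n) {x : ℝ} (hx : ∀ q : ℚ, x ≠ q) :
    x ∈ gridCell n ⌊(n : ℝ) * x⌋ := by
  have hn' : (0 : ℝ) < n := by exact_mod_cast hn
  constructor
  · rw [div_lt_iff₀' hn']
    refine lt_of_le_of_ne (Int.floor_le _) fun h => hx (⌊(n : ℝ) * x⌋ / n) ?_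
    push_cast
    rw [h]
    field_simp
  · rw [lt_div_iff₀' hn']
    exact Int.lt_floor_add_one _

theorem floor_eq_of_mem_gridCell {n : ℕ} (hn : 0 < n) {x : ℝ} {j : ℤ} (hx : x ∈ gridCell n j) :
    ⌊(n : ℝ) * x⌋ = j := by
  have hn' : (0 : ℝ) < n := by exact_mod_cast hn
  rw [Int.floor_eq_iff]
  exact ⟨((div_lt_iff₀' hn').1 hx.1).le, (lt_div_iff₀' hn').1 hx.2⟩

theorem pairwiseDisjoint_gridCell (n : ℕ) (J : Set ℤ) : J.PairwiseDisjoint (gridCell n) := by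
  rcases n.eq_zero_or_pos with rfl | hn
  -- With `n = 0` division by zero makes every cell `Ioo 0 0`, which is empty.
  · intro i _ j _ _
    simp [Function.onFun, gridCell]
  · intro i _ j _ hij
    refine disjoint_left.2 fun x hi hj => hij ?_
    rw [← floor_eq_of_mem_gridCell hn hi, floor_eq_of_mem_gridCell hn hj]

/-- Fix `m` points of the infinite set. A fine grid separates them, indices up to `n²` in absolute
value reach them, and excluding rational points keeps them off the grid endpoints. -/
theorem eventually_le_card_hitCells {u : ℝ} (hinf : (M u).Infinite) (hrat : ∀ q : ℚ, (q : ℝ) ∉ M u)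
    (m : ℕ) : ∀ᶠ n : ℕ in atTop,
      m ≤ (hitCells M (Finset.Icc (-(n : ℤ) ^ 2) ((n : ℤ) ^ 2)) (gridCell n) u).card := by
  classical
  obtain ⟨F, hF, hFm⟩ := hinf.exists_subset_card_eq m
  have h1 : ∀ᶠ n : ℕ in atTop, ∀ x ∈ F, ∀ y ∈ F, ⌊(n : ℝ) * x⌋ = ⌊(n : ℝ) * y⌋ → x = y := by
    rw [Filter.eventually_all_finset]
    intro x _
    rw [Filter.eventually_all_finset]
    intro y _
    by_cases hxy : x = y
    · exact Eventually.of_forall fun _ _ => hxy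
    · have hpos : 0 < |x - y| := abs_pos.2 (sub_ne_zero.2 hxy)
      filter_upwards [eventually_ge_atTop ⌈1 / |x - y|⌉₊] with n hn h
      have h2 := Int.abs_sub_lt_one_of_floor_eq_floor h
      rw [← mul_sub, abs_mul, Nat.abs_cast] at h2
      have h3 : 1 / |x - y| ≤ n := Nat.ceil_le.1 hn
      rw [div_le_iff₀ hpos] at h3
      linarith
  have h2 : ∀ᶠ n : ℕ in atTop, ∀ x ∈ F,
      ⌊(n : ℝ) * x⌋ ∈ Finset.Icc (-(n : ℤ) ^ 2) ((n : ℤ) ^ 2) := by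
    rw [Filter.eventually_all_finset]
    intro x _
    filter_upwards [eventually_ge_atTop ⌈|x|⌉₊] with n hn
    have h3 : |x| ≤ n := Nat.ceil_le.1 hn
    have hn0 : (0 : ℝ) ≤ n := Nat.cast_nonneg n
    have h4 := abs_le.1 h3
    rw [Finset.mem_Icc, Int.le_floor, ← Int.cast_le (R := ℝ)]
    constructor
    · push_cast
      nlinarith
    · refine (Int.floor_le _).trans ?_
      push_cast
      nlinarith
  filter_upwards [h1, h2, eventually_gt_atTop 0] with n h1 h2 hn
  rw [← hFm, ← Finset.card_image_of_injOn (s := F) (f := fun x : ℝ => ⌊(n : ℝ) * x⌋)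
    (fun x hx y hy h => h1 x hx y hy h)]
  refine Finset.card_le_card fun j hj => ?_
  obtain ⟨x, hx, rfl⟩ := Finset.mem_image.1 hj
  exact Finset.mem_filter.2 ⟨h2 x hx, x, hF hx, mem_gridCell_floor hn fun q hq =>
    hrat q (hq ▸ hF hx)⟩

/-- The random set is finite almost surely. -/
theorem ae_finite (hM : IsRandomSpectrum Z f μ M) (hZ : IsAvoidanceFamily Z) :
    ∀ᵐ u ∂μ, (M u).Finite := by
  have hμ := hM.isFiniteMeasure hZ
  have hrat : ∀ᵐ u ∂μ, ∀ q : ℚ, (q : ℝ) ∉ M u := ae_all_iff.2 fun q => hM.ae_notMem hZ q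
  have hbound : ∀ ε > 0, μ {u | (M u).Infinite} ≤ ENNReal.ofReal (3 * ε) := by
    intro ε hε
    obtain ⟨m, hm⟩ := hM.measureReal_hitCells_le (ι := ℤ) hZ hε
    let B : ℕ → Set ℝ := fun n =>
      {u | m ≤ (hitCells M (Finset.Icc (-(n : ℤ) ^ 2) ((n : ℤ) ^ 2)) (gridCell n) u).card}
    -- An infinite `M u` lies in all but finitely many `B n`, and the liminf of the `B n` inherits
    -- their uniform bound.
    have h1 : μ {u | (M u).Infinite} ≤ μ (⋃ n, ⋂ k ≥ n, B k) := by
      refine measure_mono_ae ?_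
      filter_upwards [hrat] with u hu hinf
      obtain ⟨n, hn⟩ := eventually_atTop.1 (eventually_le_card_hitCells hinf hu m)
      exact mem_iUnion.2 ⟨n, mem_iInter₂.2 hn⟩
    have hmono : Monotone fun n => ⋂ k ≥ n, B k := fun i j hij =>
      biInter_subset_biInter_left fun k (hk : j ≤ k) => le_trans hij hk
    rw [hmono.measure_iUnion] at h1
    refine h1.trans (iSup_le fun n => (measure_mono (iInter₂_subset n le_rfl)).trans ?_)
    rw [← ofReal_measureReal]
    exact ENNReal.ofReal_le_ofReal (hm _ _ (fun j => isOpen_Ioo) (pairwiseDisjoint_gridCell n _))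
  rw [ae_iff]
  refine le_antisymm ?_ bot_le
  have hlim : Tendsto (fun n : ℕ => ENNReal.ofReal (3 * (1 / ((n : ℝ) + 1)))) atTop (𝓝 0) := by
    have := (tendsto_one_div_add_atTop_nhds_zero_nat (𝕜 := ℝ)).const_mul 3
    rw [mul_zero] at this
    simpa using ENNReal.tendsto_ofReal this
  exact ge_of_tendsto' hlim fun n => hbound _ (by positivity)

end IsRandomSpectrum
end Finiteness

/-! ### Transfer of the random set to the space of compact sets. -/

section CompactsMeasure
open Filter Topology Set TopologicalSpace
open scoped ENNReal

theorem measurableSet_compacts_of_isOpen {S : Set (Compacts ℝ)} (hS : IsOpen S) :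
    MeasurableSet S :=
  MeasurableSpace.measurableSet_generateFrom hS

/-- Disjoint neighbourhoods of `m` points of `K` must all be hit by any nearby compact set, which
therefore has at least `m` points. -/
theorem isOpen_le_encard (m : ℕ) : IsOpen {K : Compacts ℝ | (m : ℕ∞) ≤ (K : Set ℝ).encard} := by
  rw [isOpen_iff_mem_nhds]
  intro K hK
  obtain ⟨F, hFK, hF⟩ := Set.exists_subset_encard_eq hK
  have hfin : F.Finite := finite_of_encard_eq_coe hF
  obtain ⟨U, hU, hd⟩ := hfin.t2_separation
  have hopen : IsOpen {K' : Compacts ℝ | ∀ x ∈ F, ((K' : Set ℝ) ∩ U x).Nonempty} := by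
    have : {K' : Compacts ℝ | ∀ x ∈ F, ((K' : Set ℝ) ∩ U x).Nonempty}
        = ⋂ x ∈ F, {K' : Compacts ℝ | ((K' : Set ℝ) ∩ U x).Nonempty} := by
      ext K'; simp
    rw [this]
    exact hfin.isOpen_biInter fun x _ => Compacts.isOpen_inter_nonempty_of_isOpen (hU x).2
  refine mem_of_superset (hopen.mem_nhds fun x hx => ⟨x, hFK hx, (hU x).1⟩) fun K' hK' => ?_
  choose! g hgK hgU using hK'
  have hinj : InjOn g F := by
    intro x hx y hy hxy
    by_contra hne
    exact disjoint_left.1 (hd hx hy hne) (hgU x hx) (hxy ▸ hgU y hy)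
  change (m : ℕ∞) ≤ (K' : Set ℝ).encard
  rw [← hF, ← hinj.encard_image]
  exact encard_le_encard (image_subset_iff.2 hgK)

theorem measurableSet_compacts_infinite : MeasurableSet {K : Compacts ℝ | ¬ (K : Set ℝ).Finite} := by
  have : {K : Compacts ℝ | ¬ (K : Set ℝ).Finite}
      = ⋂ m : ℕ, {K : Compacts ℝ | (m : ℕ∞) ≤ (K : Set ℝ).encard} := by
    ext K
    simp only [mem_ofPred_eq, mem_iInter]
    rw [← Set.encard_ne_top_iff, not_not, ENat.eq_top_iff_forall_ge]
  rw [this]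
  exact MeasurableSet.iInter fun m => measurableSet_compacts_of_isOpen (isOpen_le_encard m)

/-- Hitting events suffice: a compact set lies in an open `U` exactly when it misses some thickening
of the closed set `Uᶜ`, and containment and hitting conditions form a basis of the topology. -/
theorem measurable_compacts {α : Type*} [MeasurableSpace α] {N : α → Compacts ℝ}
    (hN : ∀ U, IsOpen U → MeasurableSet {u | ((N u : Set ℝ) ∩ U).Nonempty}) : Measurable N := by
  have hb : BorelSpace (Compacts ℝ) := ⟨rfl⟩
  have hsub : ∀ U, IsOpen U → MeasurableSet {u | (N u : Set ℝ) ⊆ U} := by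
    intro U hU
    have this : {u | (N u : Set ℝ) ⊆ U} = ⋃ n : ℕ,
        {u | ((N u : Set ℝ) ∩ Metric.thickening (1 / ((n : ℝ) + 1)) Uᶜ).Nonempty}ᶜ := by
      ext u
      simp only [mem_ofPred_eq, mem_iUnion, mem_compl_iff]
      constructor
      · intro h
        obtain ⟨δ, hδ, hd⟩ := (disjoint_compl_right_iff_subset.2 h).exists_cthickenings
          (N u).isCompact hU.isClosed_compl
        obtain ⟨n, hn⟩ := exists_nat_one_div_lt hδ
        refine ⟨n, fun ⟨x, hx, hx'⟩ => disjoint_left.1 hd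
          (Metric.self_subset_cthickening _ hx)
          (Metric.cthickening_mono hn.le _ (Metric.thickening_subset_cthickening _ _ hx'))⟩
      · rintro ⟨n, hn⟩ x hx
        by_contra hxU
        exact hn ⟨x, hx, Metric.self_subset_thickening (by positivity) _ hxU⟩
    rw [this]
    exact MeasurableSet.iUnion fun n => (hN _ Metric.isOpen_thickening).compl
  have hgen := (Compacts.isTopologicalBasis (α := ℝ)).borel_eq_generateFrom
  change @Measurable α (Compacts ℝ) _ (borel (Compacts ℝ)) N
  rw [hgen]
  refine measurable_generateFrom ?_
  rintro _ ⟨s, ⟨hs, hso⟩, rfl⟩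
  have : N ⁻¹' {K : Compacts ℝ | (K : Set ℝ) ⊆ ⋃₀ s ∧ ∀ U ∈ s, ((K : Set ℝ) ∩ U).Nonempty}
      = {u | (N u : Set ℝ) ⊆ ⋃₀ s} ∩ ⋂ U ∈ s, {u | ((N u : Set ℝ) ∩ U).Nonempty} := by
    ext u; simp
  rw [this]
  exact (hsub _ (isOpen_sUnion hso)).inter
    (MeasurableSet.biInter hs.countable fun U hU => hN U (hso U hU))

theorem isOpen_elementarySet (I : Finset (EReal × EReal)) : IsOpen (elementarySet I) := by
  have : elementarySet I = ⋃ p ∈ I, {x : ℝ | p.1 < (x : EReal) ∧ (x : EReal) < p.2} := by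
    ext x
    simp only [elementarySet, mem_ofPred_eq, mem_iUnion, exists_prop]
  rw [this]
  exact isOpen_biUnion fun p _ =>
    (isOpen_lt continuous_const continuous_coe_real_ereal).inter
      (isOpen_lt continuous_coe_real_ereal continuous_const)

/-- The complement of an elementary set is an open set and finitely many points. -/
theorem exists_isOpen_compl_elementarySet (I : Finset (EReal × EReal)) :
    ∃ U F : Set ℝ, IsOpen U ∧ F.Finite ∧ (elementarySet I)ᶜ = U ∪ F := by
  let U : Set ℝ := ⋂ p ∈ I, ({x : ℝ | (x : EReal) < p.1} ∪ {x : ℝ | p.2 < (x : EReal)})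
  have hU : IsOpen U := isOpen_biInter_finset fun p _ =>
    (isOpen_lt continuous_coe_real_ereal continuous_const).union
      (isOpen_lt continuous_const continuous_coe_real_ereal)
  have hF : (⋃ p ∈ I, {x : ℝ | (x : EReal) = p.1 ∨ (x : EReal) = p.2}).Finite := by
    refine I.finite_toSet.biUnion fun p _ => ?_
    have h1 : ∀ e : EReal, {x : ℝ | (x : EReal) = e}.Finite := fun e =>
      Set.Subsingleton.finite fun x hx y hy => EReal.coe_injective (hx.trans hy.symm)
    exact (h1 _).union (h1 _)
  have hsub : U ⊆ (elementarySet I)ᶜ := by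
    rintro x hx ⟨p, hp, h1, h2⟩
    rcases mem_iInter₂.1 hx p hp with h | h
    · exact lt_asymm h h1
    · exact lt_asymm h h2
  refine ⟨U, (elementarySet I)ᶜ \ U, hU, hF.subset ?_, (union_sdiff_cancel hsub).symm⟩
  rintro x ⟨hx, hxU⟩
  simp only [U, mem_iInter, not_forall] at hxU
  obtain ⟨p, hp, hxp⟩ := hxU
  refine mem_iUnion₂.2 ⟨p, hp, ?_⟩
  have h1 : p.1 ≤ (x : EReal) := not_lt.1 fun h => hxp (Or.inl h)
  have h2 : (x : EReal) ≤ p.2 := not_lt.1 fun h => hxp (Or.inr h)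
  rcases h1.eq_or_lt with h | h
  · exact Or.inl h.symm
  rcases h2.eq_or_lt with h' | h'
  · exact Or.inr h'
  · exact absurd ⟨p, hp, h, h'⟩ hx

/-- The spectral measure on the space of compact sets, concentrated on finite sets. -/
theorem IsAvoidanceFamily.exists_spectralMeasure {H : Type*} [NormedAddCommGroup H]
    [InnerProductSpace ℝ H] {Z : Set ℝ → H →L[ℝ] H} (hZ : IsAvoidanceFamily Z) (f : H) :
    ∃ m : Measure (Compacts ℝ),
      (∀ I : Finset (EReal × EReal), m {K | (K : Set ℝ) ⊆ elementarySet I}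
        = ENNReal.ofReal (‖Z (elementarySet I)ᶜ f‖ ^ 2)) ∧
      m {K | ¬ (K : Set ℝ).Finite} = 0 := by
  obtain ⟨μ, M, -, hMc, hMm, hMμ⟩ := hZ.exists_random_compact f
  have hM : IsRandomSpectrum Z f μ M := ⟨hMc, hMm, hMμ⟩
  let N : ℝ → Compacts ℝ := fun u => ⟨M u, hMc u⟩
  have hN : Measurable N := measurable_compacts hMm
  refine ⟨μ.map N, fun I => ?_, ?_⟩
  · rw [Measure.map_apply hN (measurableSet_compacts_of_isOpen
      (Compacts.isOpen_subsets_of_isOpen (isOpen_elementarySet I)))]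
    obtain ⟨U, F, hU, hF, hUF⟩ := exists_isOpen_compl_elementarySet I
    -- The finitely many exceptional points of the complement are almost surely not in `M`.
    have h1 : N ⁻¹' {K | (K : Set ℝ) ⊆ elementarySet I} =ᵐ[μ] {u | ¬ (M u ∩ U).Nonempty} := by
      refine Filter.eventuallyEq_set.2 ?_
      have hFa : ∀ᵐ u ∂μ, ∀ x ∈ F, x ∉ M u :=
        (ae_ball_iff hF.countable).2 fun x _ => hM.ae_notMem hZ x
      filter_upwards [hFa] with u hu
      change M u ⊆ elementarySet I ↔ ¬ (M u ∩ U).Nonempty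
      constructor
      · rintro h ⟨x, hx, hxU⟩
        have : x ∈ (elementarySet I)ᶜ := hUF ▸ Or.inl hxU
        exact this (h hx)
      · intro h x hx
        by_contra hxE
        have : x ∈ U ∪ F := hUF ▸ hxE
        rcases this with h' | h'
        · exact h ⟨x, hx, h'⟩
        · exact hu x h' hx
    rw [measure_congr h1, hMμ U hU, hUF, hZ.union _ _ hU.measurableSet hF.measurableSet,
      hZ.finite hF]
  · rw [Measure.map_apply hN measurableSet_compacts_infinite]
    exact hM.ae_finite hZ

end CompactsMeasure

/-! ### A Borel extension makes the factorization classical. -/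

section Bridge
open Filter Topology Set
open scoped ENNReal

namespace ContinuousFactorization

variable {Ω : Type*} [mΩ : MeasurableSpace Ω] {P : Measure Ω} (F : ContinuousFactorization P)

theorem intervalField_le (a b : EReal) : F.intervalField a b ≤ mΩ :=
  iSup_le fun s => iSup_le fun t => iSup_le fun h => (F.isSubSigmaField s t h.1).le

theorem isSubSigmaField_elementaryField (I : Finset (EReal × EReal)) :
    IsSubSigmaField P (F.elementaryField I) :=
  isSubSigmaField_degenerateField.sup (iSup₂_le fun _ _ => F.intervalField_le _ _)

theorem elementaryField_univ : F.elementaryField {(⊥, ⊤)} = mΩ := by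
  refine le_antisymm (F.isSubSigmaField_elementaryField _).le ?_
  conv_lhs => rw [← F.exhaust]
  refine iSup_le fun n => le_trans ?_ le_sup_right
  refine le_iSup₂_of_le (⊥, ⊤) (Finset.mem_singleton_self _) ?_
  have h : -(n : ℝ) ≤ n := by
    have : (0 : ℝ) ≤ n := Nat.cast_nonneg n
    linarith
  exact le_iSup_of_le (-(n : ℝ)) (le_iSup_of_le (n : ℝ) (le_iSup_of_le ⟨h, bot_le, le_top⟩ le_rfl))

theorem elementarySet_univ : elementarySet {(⊥, ⊤)} = univ := by
  ext x
  simp [elementarySet, EReal.bot_lt_coe, EReal.coe_lt_top]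

variable {F}

namespace IsBorelExtension

variable {G : Set ℝ → MeasurableSpace Ω}

theorem eq_top (hG : F.IsBorelExtension G) {E : Set ℝ} (hE : Eᶜ.Finite) : G E = mΩ := by
  rw [hG.eq_elementaryField {(⊥, ⊤)} E (by
    rw [elementarySet_univ]
    simpa [symmDiff_def, ← compl_eq_univ_sdiff] using hE), F.elementaryField_univ]

theorem mono (hG : F.IsBorelExtension G) {A B : Set ℝ} (hA : MeasurableSet A)
    (hB : MeasurableSet B) (h : A ⊆ B) : G A ≤ G B := by
  rw [← union_sdiff_cancel h, hG.union A (B \ A) hA (hB.diff hA) disjoint_sdiff_right]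
  exact le_sup_left

/-- Split `G A` into `G (A ∩ B)` and `G (A \ B)`. The second is independent of `G B`, so it
contributes nothing to conditioning a `G B`-measurable vector. -/
theorem condProj_condProj [IsProbabilityMeasure P] (hG : F.IsBorelExtension G) {A B : Set ℝ}
    (hA : MeasurableSet A) (hB : MeasurableSet B) (x : Lp ℝ 2 P) :
    condProj (G A) P (condProj (G B) P x) = condProj (G (A ∩ B)) P x := by
  have hm := fun E hE => (hG.isSubSigmaField E hE).le
  have h1 : G A = G (A ∩ B) ⊔ G (A \ B) := by
    rw [← hG.union _ _ (hA.inter hB) (hA.diff hB) (disjoint_sdiff_right.mono_left inter_subset_right),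
      inter_union_sdiff]
  have h2 : G (A ∩ B) ≤ G B := hG.mono (hA.inter hB) hB inter_subset_right
  rw [h1, condProj_sup_of_indep (hm B hB) (hm _ (hA.diff hB)) h2
    (hG.indep _ _ hB (hA.diff hB) disjoint_sdiff_right) (condProj_mem (hm B hB) x),
    condProj_condProj_of_le' (hm B hB) h2]

/-- Avoiding `E` corresponds to depending on `G Eᶜ` only. Points are invisible because elementary
sets are taken modulo finite sets. -/
theorem isAvoidanceFamily [IsProbabilityMeasure P] (hG : F.IsBorelExtension G) :
    IsAvoidanceFamily fun E => condProj (G Eᶜ) P where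
  empty x := by
    rw [hG.eq_top (by simp)]
    exact condProj_eq_self le_rfl (Lp.aestronglyMeasurable x)
  union A B hA hB x := by
    rw [compl_union, hG.condProj_condProj hA.compl hB.compl]
  pythagoras A _ x := condProj_norm_sq x
  tendsto E hE hanti hI x := by
    have h := condProj_tendsto_iSup (P := P) (m := fun n => G (E n)ᶜ)
      (fun n => (hG.isSubSigmaField _ (hE n).compl).le)
      (fun i j hij => hG.mono (hE i).compl (hE j).compl (compl_subset_compl.2 (hanti hij))) x
    rw [← hG.iUnion _ (fun n => (hE n).compl) (fun i j hij => compl_subset_compl.2 (hanti hij)),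
      ← compl_iInter, hI, hG.eq_top (by simp),
      condProj_eq_self le_rfl (Lp.aestronglyMeasurable x)] at h
    exact h
  singleton a x := by
    rw [hG.eq_top (by simp)]
    exact condProj_eq_self le_rfl (Lp.aestronglyMeasurable x)

theorem isClassical [IsProbabilityMeasure P] (hG : F.IsBorelExtension G) : F.IsClassical := by
  intro f hf
  obtain ⟨m, h1, h2⟩ := hG.isAvoidanceFamily.exists_spectralMeasure (hf.toLp f)
  refine ⟨m, fun I => ?_, h2⟩
  rw [h1, compl_compl, hG.eq_elementaryField I _ (by simp),
    eLpNorm_condExp_eq (F.isSubSigmaField_elementaryField I).le hf]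

end IsBorelExtension
end ContinuousFactorization
end Bridge

/-! ### Joins and intersections under independence. -/

section IndependentSup
open Filter Topology Set

variable {Ω : Type*} {m A B C : MeasurableSpace Ω} [mΩ : MeasurableSpace Ω] {P : Measure Ω}
  [IsProbabilityMeasure P]

theorem le_degenerateField_of_indep_self (hm : m ≤ mΩ) (h : Indep m m P) :
    m ≤ degenerateField P := by
  intro s hs
  have hD := isSubSigmaField_degenerateField (P := P)
  rcases measure_eq_zero_or_one_of_indep_self h hs with h0 | h1
  · exact hD.null s (hm s hs) h0
  · have := hD.null sᶜ (hm s hs).compl ((prob_compl_eq_zero_iff (hm s hs)).2 h1)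
    simpa using this.compl

/-- If `A`, `B`, `C` are jointly independent, then `A ⊔ C` is independent of `B`. -/
theorem indep_sup_right_comm (hA : A ≤ mΩ) (hB : B ≤ mΩ) (hC : C ≤ mΩ) (hAB : Indep A B P)
    (hABC : Indep (A ⊔ B) C P) : Indep (A ⊔ C) B P := by
  refine IndepSets.indep (sup_le hA hC) hB (isPiSystem_inter A C)
    (@MeasurableSpace.isPiSystem_measurableSet _ B) (sup_eq_generateFrom_inter A C)
    (@MeasurableSpace.generateFrom_measurableSet _ B).symm ?_
  rw [IndepSets_iff]
  rintro _ b ⟨a, c, ha, hc, rfl⟩ hb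
  have hA' : A ≤ A ⊔ B := le_sup_left
  have hB' : B ≤ A ⊔ B := le_sup_right
  rw [inter_right_comm, (Indep_iff _ _ _).1 hABC (a ∩ b) c ((hA' _ ha).inter (hB' _ hb)) hc,
    (Indep_iff _ _ _).1 hABC a c (hA' _ ha) hc, (Indep_iff _ _ _).1 hAB a b ha hb]
  ring

/-- Decreasing sequences of σ-fields inside two independent σ-fields. -/
theorem iInf_sup_iInf_le_of_indep {a b : ℕ → MeasurableSpace Ω}
    (ha : ∀ n, IsSubSigmaField P (a n)) (hb : ∀ n, IsSubSigmaField P (b n)) (ha' : Antitone a)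
    (hb' : Antitone b) (h : Indep (a 0) (b 0) P) :
    ⨅ n, (a n ⊔ b n) ≤ (⨅ n, a n) ⊔ ⨅ n, b n := by
  -- Freeze the second sequence at `b k` while intersecting the first, then intersect over `k`.
  have h1 : ∀ k, ⨅ n, (a n ⊔ b n) ≤ (⨅ n, a n) ⊔ b k := by
    intro k
    rw [← ha'.iInf_nat_add k]
    refine le_trans (le_iInf fun n => ?_) (iInf_sup_le_of_indep (m := fun n => a (n + k))
      (fun n => ha _) (fun i j hij => ha' (by omega)) (ha 0).le (fun n => ha' (Nat.zero_le _))
      (hb k).le (indep_of_indep_of_le_right h (hb' (Nat.zero_le _))))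
    exact (iInf_le _ (n + k)).trans (sup_le_sup_left (hb' (by omega)) _)
  have h2 : IsSubSigmaField P (⨅ n, a n) := IsSubSigmaField.iInf ha
  rw [sup_comm]
  refine le_trans (le_iInf fun k => ?_) (iInf_sup_le_of_indep hb hb' (hb 0).le
    (fun n => hb' (Nat.zero_le _)) h2.le (indep_of_indep_of_le_right h.symm (iInf_le _ 0)))
  rw [sup_comm]
  exact h1 k

end IndependentSup

/-! ### The σ-fields of open sets. -/

section OpenField
open Filter Topology Set

namespace ContinuousFactorization

variable {Ω : Type*} {m : MeasurableSpace Ω} [mΩ : MeasurableSpace Ω] {P : Measure Ω}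
  (F : ContinuousFactorization P)

theorem field_le_degenerateField [IsProbabilityMeasure P] (s : ℝ) :
    F.field s s ≤ degenerateField P :=
  le_degenerateField_of_indep_self (F.isSubSigmaField s s le_rfl).le (F.indep s s s le_rfl le_rfl)

theorem field_mono {s t a b : ℝ} (hst : s ≤ t) (has : a ≤ s) (htb : t ≤ b) :
    F.field s t ≤ F.field a b := by
  rw [← F.sup_eq a s b has (hst.trans htb), ← F.sup_eq s t b hst htb]
  exact le_sup_left.trans le_sup_right

/-- The σ-field generated by the cells, with indices in `S`, of the grid `x 0 ≤ ⋯ ≤ x n`. -/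
@[reducible] def gridField (x : ℕ → ℝ) (S : Set ℕ) (n : ℕ) : MeasurableSpace Ω :=
  degenerateField P ⊔ ⨆ (k : ℕ) (_ : k < n ∧ k ∈ S), F.field (x k) (x (k + 1))

theorem isSubSigmaField_gridField {x : ℕ → ℝ} (hx : Monotone x) (S : Set ℕ) (n : ℕ) :
    IsSubSigmaField P (F.gridField x S n) :=
  isSubSigmaField_degenerateField.sup
    (iSup₂_le fun k _ => (F.isSubSigmaField _ _ (hx k.le_succ)).le)

theorem field_le_gridField {x : ℕ → ℝ} {S : Set ℕ} {n k : ℕ} (hk : k < n) (hS : k ∈ S) :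
    F.field (x k) (x (k + 1)) ≤ F.gridField x S n :=
  le_trans (le_iSup₂_of_le k ⟨hk, hS⟩ le_rfl) le_sup_right

theorem gridField_le {x : ℕ → ℝ} (hx : Monotone x) (S : Set ℕ) (n : ℕ) :
    F.gridField x S n ≤ F.field (x 0) (x n) :=
  sup_le (F.isSubSigmaField _ _ (hx (Nat.zero_le n))).degenerateField_le
    (iSup₂_le fun k hk => F.field_mono (hx k.le_succ) (hx (Nat.zero_le k)) (hx hk.1))

theorem gridField_succ_le (x : ℕ → ℝ) (S : Set ℕ) (n : ℕ) :
    F.gridField x S (n + 1) ≤ F.gridField x S n ⊔ F.field (x n) (x (n + 1)) := by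
  refine sup_le (le_sup_left.trans le_sup_left) (iSup₂_le fun k hk => ?_)
  rcases Nat.lt_succ_iff_lt_or_eq.1 hk.1 with h | rfl
  · exact (F.field_le_gridField h hk.2).trans le_sup_left
  · exact le_sup_right

theorem gridField_succ_le_of_notMem (x : ℕ → ℝ) {S : Set ℕ} {n : ℕ} (hn : n ∉ S) :
    F.gridField x S (n + 1) ≤ F.gridField x S n := by
  refine sup_le le_sup_left (iSup₂_le fun k hk => F.field_le_gridField ?_ hk.2)
  rcases Nat.lt_succ_iff_lt_or_eq.1 hk.1 with h | rfl
  · exact h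
  · exact absurd hk.2 hn

variable [IsProbabilityMeasure P]

/-- Induction on the number of cells: the last cell belongs to at most one of the two families and
is independent of everything generated by the earlier cells. -/
theorem indep_gridField {x : ℕ → ℝ} (hx : Monotone x) (n : ℕ) :
    ∀ {S T : Set ℕ}, Disjoint S T → Indep (F.gridField x S n) (F.gridField x T n) P := by
  have hle := fun S n => (F.isSubSigmaField_gridField hx S n).le
  induction n with
  | zero =>
    intro S T _
    have h := fun S => F.gridField_le hx S 0
    exact indep_of_indep_of_le (F.indep (x 0) (x 0) (x 0) le_rfl le_rfl) (h S) (h T)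
  | succ n ih =>
    have key : ∀ {S T : Set ℕ}, Disjoint S T → n ∉ T →
        Indep (F.gridField x S (n + 1)) (F.gridField x T (n + 1)) P := by
      intro S T hST hn
      refine indep_of_indep_of_le ?_ (F.gridField_succ_le x S n)
        (F.gridField_succ_le_of_notMem x hn)
      exact indep_sup_right_comm (hle S n) (hle T n) (F.isSubSigmaField _ _ (hx n.le_succ)).le
        (ih hST) (indep_of_indep_of_le_left
          (F.indep (x 0) (x n) (x (n + 1)) (hx (Nat.zero_le n)) (hx n.le_succ))
          (sup_le (F.gridField_le hx S n) (F.gridField_le hx T n)))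
    intro S T hST
    by_cases hn : n ∈ T
    · exact (key hST.symm (disjoint_right.1 hST hn)).symm
    · exact key hST hn

theorem field_le_of_grid (hm : degenerateField P ≤ m) {y : ℕ → ℝ} (hy : Monotone y) {n : ℕ}
    (h : ∀ k < n, F.field (y k) (y (k + 1)) ≤ m) : F.field (y 0) (y n) ≤ m := by
  induction n with
  | zero => exact (F.field_le_degenerateField _).trans hm
  | succ n ih =>
    rw [← F.sup_eq (y 0) (y n) (y (n + 1)) (hy (Nat.zero_le n)) (hy n.le_succ)]
    exact sup_le (ih fun k hk => h k (hk.trans n.lt_succ_self)) (h n n.lt_succ_self)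

theorem interval_le_gridField {x : ℕ → ℝ} (hx : Monotone x) {S : Set ℕ} {n : ℕ} {s t : ℝ}
    (hst : s ≤ t) (h0 : x 0 ≤ s) (hn : t ≤ x n)
    (hS : ∀ k < n, (Icc (x k) (x (k + 1)) ∩ Icc s t).Nonempty → k ∈ S) :
    F.field s t ≤ F.gridField x S n := by
  -- The grid clipped to `[s, t]`. Cells that collapse to a point carry a degenerate σ-field; the
  -- others come from cells meeting `[s, t]`.
  let y : ℕ → ℝ := fun k => max s (min (x k) t)
  have hy : Monotone y := fun i j hij => max_le_max le_rfl (min_le_min (hx hij) le_rfl)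
  have hy0 : y 0 = s := max_eq_left ((min_le_left _ _).trans h0)
  have hyn : y n = t := by simp only [y, min_eq_right hn, max_eq_right hst]
  rw [← hy0, ← hyn]
  refine F.field_le_of_grid le_sup_left hy fun k hk => ?_
  rcases (hy k.le_succ).eq_or_lt with h | h
  · change y k = y (k + 1) at h
    rw [← h]
    exact (F.field_le_degenerateField _).trans le_sup_left
  change max s (min (x k) t) < max s (min (x (k + 1)) t) at h
  have h1 : s < min (x (k + 1)) t := by
    rcases lt_max_iff.1 h with h' | h'
    · exact absurd h' (not_lt.2 (le_max_left _ _))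
    · exact (le_max_left _ _).trans_lt h'
  have h2 : min (x k) t < min (x (k + 1)) t := by
    rw [max_eq_right h1.le] at h
    exact (le_max_right _ _).trans_lt h
  have h3 : x k < t := by
    by_contra h'
    rw [min_eq_right (not_lt.1 h')] at h2
    exact absurd h2 (not_lt.2 (min_le_right _ _))
  have h4 : k ∈ S := by
    refine hS k hk ⟨max s (x k), ⟨le_max_right _ _, max_le ?_ (hx k.le_succ)⟩,
      le_max_left _ _, max_le hst h3.le⟩
    exact h1.le.trans (min_le_left _ _)
  refine (F.field_mono (hy k.le_succ) ?_ ?_).trans (F.field_le_gridField hk h4)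
  · simp only [y, min_eq_left h3.le]
    exact le_max_right _ _
  · change max s (min (x (k + 1)) t) ≤ _
    rw [max_eq_right h1.le]
    exact min_le_left _ _

end ContinuousFactorization

/-- Subordinating a partition of a compact interval to an open cover. -/
theorem exists_monotone_grid_of_open_cover {ι : Type*} {a b : ℝ} (hab : a ≤ b) {c : ι → Set ℝ}
    (hc : ∀ i, IsOpen (c i)) (hcov : Icc a b ⊆ ⋃ i, c i) :
    ∃ (x : ℕ → ℝ) (n : ℕ), Monotone x ∧ x 0 = a ∧ x n = b ∧
      ∀ k, ∃ i, Icc (x k) (x (k + 1)) ⊆ c i := by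
  obtain ⟨t, h0, hmono, ⟨n, hn⟩, hi⟩ := exists_monotone_Icc_subset_open_cover_Icc hab
    (c := fun i => ((↑) : Icc a b → ℝ) ⁻¹' c i)
    (fun i => (hc i).preimage continuous_subtype_val) fun x _ => by
      have := hcov x.2
      simpa only [mem_iUnion, mem_preimage] using this
  refine ⟨fun k => t k, n, fun i j hij => hmono hij, h0, hn n le_rfl, fun k => ?_⟩
  obtain ⟨i, hi⟩ := hi k
  refine ⟨i, fun y hy => ?_⟩
  exact @hi ⟨y, (t k).2.1.trans hy.1, hy.2.trans (t (k + 1)).2.2⟩ ⟨hy.1, hy.2⟩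

namespace ContinuousFactorization

variable {Ω : Type*} {m : MeasurableSpace Ω} [mΩ : MeasurableSpace Ω] {P : Measure Ω}
  (F : ContinuousFactorization P)

theorem field_le_of_cover [IsProbabilityMeasure P] (hm : degenerateField P ≤ m) {ι : Type*}
    {c : ι → Set ℝ} (hc : ∀ i, IsOpen (c i))
    (h : ∀ i a b, a ≤ b → Icc a b ⊆ c i → F.field a b ≤ m)
    {s t : ℝ} (hst : s ≤ t) (hcov : Icc s t ⊆ ⋃ i, c i) : F.field s t ≤ m := by
  obtain ⟨x, n, hx, rfl, rfl, hi⟩ := exists_monotone_grid_of_open_cover hst hc hcov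
  refine F.field_le_of_grid hm hx fun k _ => ?_
  obtain ⟨i, hi⟩ := hi k
  exact h i _ _ (hx k.le_succ) hi

/-- The σ-field of an open set, generated by the compact intervals inside. -/
@[reducible] def openField (U : Set ℝ) : MeasurableSpace Ω :=
  degenerateField P ⊔ ⨆ p : {p : ℝ × ℝ // p.1 ≤ p.2 ∧ Icc p.1 p.2 ⊆ U}, F.field p.1.1 p.1.2

theorem isSubSigmaField_openField (U : Set ℝ) : IsSubSigmaField P (F.openField U) :=
  isSubSigmaField_degenerateField.sup (iSup_le fun p => (F.isSubSigmaField _ _ p.2.1).le)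

theorem field_le_openField {U : Set ℝ} {s t : ℝ} (hst : s ≤ t) (h : Icc s t ⊆ U) :
    F.field s t ≤ F.openField U :=
  le_trans (le_iSup_of_le ⟨(s, t), hst, h⟩ le_rfl) le_sup_right

theorem openField_le (hm : degenerateField P ≤ m) {U : Set ℝ}
    (h : ∀ s t, s ≤ t → Icc s t ⊆ U → F.field s t ≤ m) : F.openField U ≤ m :=
  sup_le hm (iSup_le fun p => h _ _ p.2.1 p.2.2)

theorem openField_mono {U V : Set ℝ} (h : U ⊆ V) : F.openField U ≤ F.openField V :=
  F.openField_le le_sup_left fun _ _ hst hU => F.field_le_openField hst (hU.trans h)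

/-- A compact interval in `U ∪ V` can be subdivided into pieces each contained in `U` or in `V`. -/
theorem openField_union_le [IsProbabilityMeasure P] {U V : Set ℝ} (hU : IsOpen U)
    (hV : IsOpen V) : F.openField (U ∪ V) ≤ F.openField U ⊔ F.openField V := by
  refine F.openField_le (le_sup_left.trans le_sup_left) fun s t hst h => ?_
  refine F.field_le_of_cover (le_sup_left.trans le_sup_left) (c := fun b => cond b U V)
    (by rintro (_ | _) <;> assumption) ?_ hst (by rwa [← union_eq_iUnion])
  rintro (_ | _) a b hab hab'
  · exact (F.field_le_openField hab hab').trans le_sup_right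
  · exact (F.field_le_openField hab hab').trans le_sup_left

/-- By directedness only finitely many compact intervals on each side matter. Their unions `K` and
`L` are disjoint compact sets, so a sufficiently fine grid has no cell meeting both, and
independence of disjoint families of cells applies. -/
theorem indep_openField [IsProbabilityMeasure P] {U V : Set ℝ} (hUV : Disjoint U V) :
    Indep (F.openField U) (F.openField V) P := by
  let f : (W : Set ℝ) → Finset {p : ℝ × ℝ // p.1 ≤ p.2 ∧ Icc p.1 p.2 ⊆ W} → MeasurableSpace Ω :=
    fun W T => degenerateField P ⊔ ⨆ p ∈ T, F.field p.1.1 p.1.2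
  have hf : ∀ W, F.openField W = ⨆ T, f W T := fun W => by
    rw [openField, iSup_eq_iSup_finset, sup_iSup]
  have hfle : ∀ W T, f W T ≤ mΩ := fun W T =>
    sup_le isSubSigmaField_degenerateField.le
      (iSup₂_le fun p _ => (F.isSubSigmaField _ _ p.2.1).le)
  have hfmono : ∀ W, Monotone (f W) := fun W S T hST =>
    sup_le_sup_left (biSup_mono fun p hp => hST hp) _
  rw [hf U, hf V]
  refine indep_iSup_of_directed_le (fun S => Indep.symm ?_) (hfle U)
    (iSup_le (hfle V)) (hfmono U).directed_le
  refine indep_iSup_of_directed_le (fun T => Indep.symm ?_) (hfle V)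
    (hfle U S) (hfmono V).directed_le
  have hc : ∀ (W : Set ℝ) (T : Finset {p : ℝ × ℝ // p.1 ≤ p.2 ∧ Icc p.1 p.2 ⊆ W}),
      IsCompact (⋃ p ∈ T, Icc p.1.1 p.1.2) := fun W T => T.isCompact_biUnion fun p _ => isCompact_Icc
  have hsub : ∀ (W : Set ℝ) (T : Finset {p : ℝ × ℝ // p.1 ≤ p.2 ∧ Icc p.1 p.2 ⊆ W}),
      (⋃ p ∈ T, Icc p.1.1 p.1.2) ⊆ W := fun W T => iUnion₂_subset fun p _ => p.2.2
  have hd := hUV.mono (hsub U S) (hsub V T)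
  have hmem : ∀ {W : Set ℝ} {T : Finset {p : ℝ × ℝ // p.1 ≤ p.2 ∧ Icc p.1 p.2 ⊆ W}},
      ∀ p ∈ T, Icc p.1.1 p.1.2 ⊆ ⋃ p ∈ T, Icc p.1.1 p.1.2 := fun p hp =>
    subset_iUnion₂ (s := fun p _ => Icc p.1.1 p.1.2) p hp
  set K := ⋃ p ∈ S, Icc p.1.1 p.1.2
  set L := ⋃ p ∈ T, Icc p.1.1 p.1.2
  obtain ⟨R, hR⟩ := ((hc U S).union (hc V T)).isBounded.subset_closedBall 0
  rw [Real.closedBall_eq_Icc, zero_sub, zero_add] at hR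
  -- When both compact sets are empty `R` may be negative; `max R 0` keeps the gridded interval
  -- nonempty.
  have hR' : Icc (-max R 0) (max R 0) ⊇ K ∪ L := hR.trans
    (Icc_subset_Icc (neg_le_neg (le_max_left _ _)) (le_max_left _ _))
  obtain ⟨x, n, hx, hx0, hxn, hi⟩ := exists_monotone_grid_of_open_cover
    (a := -max R 0) (b := max R 0) (neg_le_self (le_max_right _ _))
    (c := fun b => cond b Kᶜ Lᶜ)
    (by
      rintro (_ | _)
      · exact (hc V T).isClosed.isOpen_compl
      · exact (hc U S).isClosed.isOpen_compl)
    (by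
      rw [← union_eq_iUnion, ← compl_inter, hd.inter_eq, compl_empty]
      exact subset_univ _)
  -- The cells meeting `K`. Every cell lies in `Kᶜ` or in `Lᶜ`, so the cells meeting `L` all belong
  -- to `Zᶜ`.
  let Z : Set ℕ := {k | (Icc (x k) (x (k + 1)) ∩ K).Nonempty}
  have hin : ∀ p : ℝ × ℝ, p.1 ≤ p.2 → Icc p.1 p.2 ⊆ K ∪ L → x 0 ≤ p.1 ∧ p.2 ≤ x n := by
    intro p hp hp'
    rw [hx0, hxn]
    exact ⟨(hR' (hp' (left_mem_Icc.2 hp))).1, (hR' (hp' (right_mem_Icc.2 hp))).2⟩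
  refine indep_of_indep_of_le (F.indep_gridField hx n (disjoint_compl_right (a := Z))) ?_ ?_
  · refine sup_le le_sup_left (iSup₂_le fun p hp => ?_)
    have h := hin p.1 p.2.1 ((hmem p hp).trans subset_union_left)
    exact F.interval_le_gridField hx p.2.1 h.1 h.2 fun k _ hk =>
      hk.mono (inter_subset_inter_right _ (hmem p hp))
  · refine sup_le le_sup_left (iSup₂_le fun p hp => ?_)
    have h := hin p.1 p.2.1 ((hmem p hp).trans subset_union_right)
    refine F.interval_le_gridField hx p.2.1 h.1 h.2 fun k _ ⟨y, hy, hyp⟩ ⟨z, hz, hzK⟩ => ?_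
    obtain ⟨_ | _, hi⟩ := hi k
    · exact hi hy (hmem p hp hyp)
    · exact hi hz hzK

theorem field_le_openField_of_Ioo {U : Set ℝ} {s t : ℝ} (hst : s < t) (h : Ioo s t ⊆ U) :
    F.field s t ≤ F.openField U := by
  rw [← F.continuous s t hst]
  refine iSup₂_le fun ε hε => F.field_le_openField hε.2 fun x hx => h ⟨?_, ?_⟩
  · linarith [hx.1]
  · linarith [hx.2]

theorem elementaryField_le_openField [IsProbabilityMeasure P] {I : Finset (EReal × EReal)}
    {V : Set ℝ} (h : elementarySet I ⊆ V) : F.elementaryField I ≤ F.openField V := by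
  refine sup_le le_sup_left (iSup₂_le fun p hp => iSup_le fun s => iSup_le fun t =>
    iSup_le fun hst => ?_)
  rcases hst.1.eq_or_lt with rfl | hlt
  · exact (F.field_le_degenerateField _).trans le_sup_left
  · refine F.field_le_openField_of_Ioo hlt fun x hx => h ⟨p, hp, ?_, ?_⟩
    · exact hst.2.1.trans_lt (EReal.coe_lt_coe_iff.2 hx.1)
    · exact (EReal.coe_lt_coe_iff.2 hx.2).trans_le hst.2.2

theorem openField_elementarySet [IsProbabilityMeasure P] (I : Finset (EReal × EReal)) :
    F.openField (elementarySet I) = F.elementaryField I := by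
  refine le_antisymm (F.openField_le le_sup_left fun s t hst h => ?_)
    (F.elementaryField_le_openField Subset.rfl)
  refine F.field_le_of_cover le_sup_left
    (c := fun p : I => {x : ℝ | p.1.1 < (x : EReal) ∧ (x : EReal) < p.1.2})
    (fun p => (isOpen_lt continuous_const continuous_coe_real_ereal).inter
      (isOpen_lt continuous_coe_real_ereal continuous_const)) ?_ hst fun x hx => ?_
  · intro p a b hab hp
    refine le_trans (le_trans ?_ (le_iSup₂_of_le p.1 p.2 le_rfl)) le_sup_right
    exact le_iSup_of_le a (le_iSup_of_le b (le_iSup_of_le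
      ⟨hab, (hp (left_mem_Icc.2 hab)).1.le, (hp (right_mem_Icc.2 hab)).2.le⟩ le_rfl))
  · obtain ⟨p, hp, hx⟩ := h hx
    exact mem_iUnion.2 ⟨⟨p, hp⟩, hx⟩

end ContinuousFactorization
end OpenField

/-! ### The candidate extension, by outer limits on compact sets and inner limits on all sets. -/

section BorelField
open Filter Topology Set

theorem exists_thickening_one_div_subset {K U : Set ℝ} (hK : IsCompact K) (hU : IsOpen U)
    (h : K ⊆ U) : ∃ n : ℕ, Metric.thickening (1 / ((n : ℝ) + 1)) K ⊆ U := by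
  obtain ⟨δ, hδ, h⟩ := hK.exists_thickening_subset_open hU h
  obtain ⟨n, hn⟩ := exists_nat_one_div_lt hδ
  exact ⟨n, (Metric.thickening_mono hn.le _).trans h⟩

theorem antitone_thickening_one_div (K : Set ℝ) :
    Antitone fun n : ℕ => Metric.thickening (1 / ((n : ℝ) + 1)) K :=
  fun _ _ hij => Metric.thickening_mono (Nat.one_div_le_one_div hij) _

namespace ContinuousFactorization

variable {Ω : Type*} {m : MeasurableSpace Ω} [mΩ : MeasurableSpace Ω] {P : Measure Ω}
  (F : ContinuousFactorization P)

/-- The σ-field of a compact set: the intersection of the σ-fields of its neighbourhoods. -/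
@[reducible] def compactField (K : Set ℝ) : MeasurableSpace Ω :=
  ⨅ n : ℕ, F.openField (Metric.thickening (1 / ((n : ℝ) + 1)) K)

theorem isSubSigmaField_compactField (K : Set ℝ) : IsSubSigmaField P (F.compactField K) :=
  IsSubSigmaField.iInf fun _ => F.isSubSigmaField_openField _

theorem compactField_mono {K L : Set ℝ} (h : K ⊆ L) : F.compactField K ≤ F.compactField L :=
  iInf_mono fun _ => F.openField_mono (Metric.thickening_subset_of_subset _ h)

theorem compactField_le_openField {K U : Set ℝ} (hK : IsCompact K) (hU : IsOpen U) (h : K ⊆ U) :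
    F.compactField K ≤ F.openField U := by
  obtain ⟨n, hn⟩ := exists_thickening_one_div_subset hK hU h
  exact (iInf_le _ n).trans (F.openField_mono hn)

theorem openField_thickening_antitone (K : Set ℝ) :
    Antitone fun n : ℕ => F.openField (Metric.thickening (1 / ((n : ℝ) + 1)) K) :=
  fun _ _ hij => F.openField_mono (antitone_thickening_one_div K hij)

/-- The σ-field of an arbitrary set, generated by its compact subsets. -/
@[reducible] def borelField (E : Set ℝ) : MeasurableSpace Ω :=
  ⨆ K : {K : Set ℝ // IsCompact K ∧ K ⊆ E}, F.compactField K

theorem compactField_le_borelField {K E : Set ℝ} (hK : IsCompact K) (h : K ⊆ E) :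
    F.compactField K ≤ F.borelField E :=
  le_iSup_of_le (f := fun K : {K : Set ℝ // IsCompact K ∧ K ⊆ E} => F.compactField K)
    ⟨K, hK, h⟩ le_rfl

theorem isSubSigmaField_borelField (E : Set ℝ) : IsSubSigmaField P (F.borelField E) :=
  (F.isSubSigmaField_compactField ∅).mono
    (F.compactField_le_borelField isCompact_empty (empty_subset E))
    (iSup_le fun K => (F.isSubSigmaField_compactField K).le)

theorem borelField_mono {E E' : Set ℝ} (h : E ⊆ E') : F.borelField E ≤ F.borelField E' :=
  iSup_le fun K => F.compactField_le_borelField K.2.1 (K.2.2.trans h)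

theorem borelField_of_isOpen {U : Set ℝ} (hU : IsOpen U) : F.borelField U = F.openField U := by
  refine le_antisymm (iSup_le fun K => F.compactField_le_openField K.2.1 hU K.2.2)
    (F.openField_le (F.isSubSigmaField_borelField U).degenerateField_le fun s t hst h => ?_)
  refine le_trans (le_iInf fun n => F.field_le_openField hst ?_)
    (F.compactField_le_borelField isCompact_Icc h)
  exact Metric.self_subset_thickening (by positivity) _

variable [IsProbabilityMeasure P]

theorem exists_indep_openField_thickening {K L : Set ℝ} (hK : IsCompact K) (hL : IsCompact L)
    (h : Disjoint K L) : ∃ n : ℕ, Indep (F.openField (Metric.thickening (1 / ((n : ℝ) + 1)) K))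
      (F.openField (Metric.thickening (1 / ((n : ℝ) + 1)) L)) P := by
  obtain ⟨δ, hδ, hd⟩ := h.exists_thickenings hK hL.isClosed
  obtain ⟨n, hn⟩ := exists_nat_one_div_lt hδ
  exact ⟨n, F.indep_openField (hd.mono (Metric.thickening_mono hn.le _)
    (Metric.thickening_mono hn.le _))⟩

/-- Compact subsets of disjoint sets have disjoint neighbourhoods; the rest is a directed supremum
on each side. No assumption on spectra enters. -/
theorem indep_borelField {E E' : Set ℝ} (h : Disjoint E E') :
    Indep (F.borelField E) (F.borelField E') P := by
  have hdir : ∀ E : Set ℝ, Directed (· ≤ ·)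
      fun K : {K : Set ℝ // IsCompact K ∧ K ⊆ E} => F.compactField K := fun E K L =>
    ⟨⟨K ∪ L, K.2.1.union L.2.1, union_subset K.2.2 L.2.2⟩,
      F.compactField_mono subset_union_left, F.compactField_mono subset_union_right⟩
  have hle := fun K => (F.isSubSigmaField_compactField K).le
  refine indep_iSup_of_directed_le (fun K => Indep.symm ?_) (fun K => hle K)
    (F.isSubSigmaField_borelField E').le (hdir E)
  refine indep_iSup_of_directed_le (fun L => Indep.symm ?_) (fun L => hle L) (hle K) (hdir E')
  obtain ⟨n, hn⟩ := F.exists_indep_openField_thickening K.2.1 L.2.1 (h.mono K.2.2 L.2.2)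
  exact indep_of_indep_of_le hn (iInf_le _ n) (iInf_le _ n)

theorem compactField_union_le {K L : Set ℝ} (hK : IsCompact K) (hL : IsCompact L)
    (h : Disjoint K L) : F.compactField (K ∪ L) ≤ F.compactField K ⊔ F.compactField L := by
  obtain ⟨n, hn⟩ := F.exists_indep_openField_thickening hK hL h
  have hK' := F.openField_thickening_antitone K
  have hL' := F.openField_thickening_antitone L
  -- Intersection and join commute only under independence, so both sequences start at an index
  -- where the thickenings are already independent.
  have key := iInf_sup_iInf_le_of_indep
    (a := fun k => F.openField (Metric.thickening (1 / (((k + n : ℕ) : ℝ) + 1)) K))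
    (b := fun k => F.openField (Metric.thickening (1 / (((k + n : ℕ) : ℝ) + 1)) L))
    (fun _ => F.isSubSigmaField_openField _) (fun _ => F.isSubSigmaField_openField _)
    (fun i j hij => hK' (by omega)) (fun i j hij => hL' (by omega)) (by simpa using hn)
  rw [hK'.iInf_nat_add n, hL'.iInf_nat_add n] at key
  refine le_trans (le_iInf fun k => ?_) key
  refine (iInf_le _ (k + n)).trans ?_
  rw [Metric.thickening_union]
  exact F.openField_union_le Metric.isOpen_thickening Metric.isOpen_thickening

theorem compactField_biUnion_le {K : ℕ → Set ℝ} (hK : ∀ i, IsCompact (K i))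
    (hd : Pairwise (Function.onFun Disjoint K)) (hm : F.compactField ∅ ≤ m)
    (h : ∀ i, F.compactField (K i) ≤ m) (n : ℕ) : F.compactField (⋃ i < n, K i) ≤ m := by
  induction n with
  | zero => simpa using hm
  | succ n ih =>
    rw [biUnion_lt_succ]
    refine (F.compactField_union_le ((finite_lt_nat n).isCompact_biUnion fun i _ => hK i) (hK n)
      ?_).trans (sup_le ih (h n))
    exact disjoint_iUnion₂_left.2 fun i hi => hd hi.ne

/-- Intervals can be cut at `x`, so `{x}ᶜ` already carries everything. The σ-field of `{x}` is
independent of it, hence of itself. -/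
theorem borelField_singleton_le (x : ℝ) : F.borelField {x} ≤ degenerateField P := by
  have h1 : elementarySet {(⊥, (x : EReal)), ((x : EReal), ⊤)} = {x}ᶜ := by
    ext y
    simp [elementarySet, EReal.bot_lt_coe, EReal.coe_lt_top, EReal.coe_lt_coe_iff]
  have h2 : F.borelField {x}ᶜ = mΩ := by
    rw [borelField_of_isOpen F isOpen_compl_singleton, ← h1, openField_elementarySet]
    refine le_antisymm (F.isSubSigmaField_elementaryField _).le ?_
    have h3 : ∀ s t : ℝ, s ≤ x → x ≤ t →
        F.field s t ≤ F.elementaryField {(⊥, (x : EReal)), ((x : EReal), ⊤)} := by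
      intro s t hs ht
      rw [← F.sup_eq s x t hs ht]
      refine sup_le (le_trans ?_ le_sup_right) (le_trans ?_ le_sup_right)
      · refine le_iSup₂_of_le (⊥, (x : EReal)) (by simp) ?_
        exact le_iSup_of_le s (le_iSup_of_le x (le_iSup_of_le ⟨hs, bot_le, le_rfl⟩ le_rfl))
      · refine le_iSup₂_of_le ((x : EReal), ⊤) (by simp) ?_
        exact le_iSup_of_le x (le_iSup_of_le t (le_iSup_of_le ⟨ht, le_rfl, le_top⟩ le_rfl))
    conv_lhs => rw [← F.exhaust]
    refine iSup_le fun n => ?_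
    obtain ⟨N, hN⟩ := exists_nat_ge |x|
    have hN' := abs_le.1 (hN.trans (Nat.cast_le.2 (le_max_left N n) : (N : ℝ) ≤ (max N n : ℕ)))
    have hn : (n : ℝ) ≤ (max N n : ℕ) := Nat.cast_le.2 (le_max_right N n)
    refine le_trans (F.field_mono ?_ (neg_le_neg hn) hn) (h3 _ _ hN'.1 hN'.2)
    linarith [(Nat.cast_nonneg n : (0 : ℝ) ≤ n)]
  have h4 := F.indep_borelField (disjoint_compl_right (a := ({x} : Set ℝ)))
  rw [h2] at h4
  have hle := (F.isSubSigmaField_borelField {x}).le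
  exact le_degenerateField_of_indep_self hle (indep_of_indep_of_le_right h4 hle)

end ContinuousFactorization
end BorelField

/-! ### Regularity of the hitting mass for measures on finite sets. -/

section FiniteSpectrum
open Filter Topology Set TopologicalSpace
open scoped ENNReal

theorem exists_elementarySet_exhaustion {V : Set ℝ} (hV : IsOpen V) :
    ∃ I : ℕ → Finset (EReal × EReal), Monotone (fun n => elementarySet (I n)) ∧
      ⋃ n, elementarySet (I n) = V := by
  classical
  obtain ⟨q, hq⟩ := exists_surjective_nat (ℚ × ℚ)
  let e : ℕ → EReal × EReal := fun k => (((q k).1 : ℝ), ((q k).2 : ℝ))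
  let I : ℕ → Finset (EReal × EReal) := fun n =>
    ((Finset.range n).filter fun k => Ioo ((q k).1 : ℝ) (q k).2 ⊆ V).image e
  have hI : ∀ n x, x ∈ elementarySet (I n) ↔
      ∃ k < n, Ioo ((q k).1 : ℝ) (q k).2 ⊆ V ∧ x ∈ Ioo ((q k).1 : ℝ) (q k).2 := by
    intro n x
    simp [elementarySet, I, e, and_assoc]
  refine ⟨I, fun i j hij x hx => ?_, ?_⟩
  · obtain ⟨k, hk, h⟩ := (hI i x).1 hx
    exact (hI j x).2 ⟨k, hk.trans_le hij, h⟩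
  · ext x
    simp only [mem_iUnion, hI]
    constructor
    · rintro ⟨n, k, -, h, hx⟩
      exact h hx
    · intro hx
      obtain ⟨a, b, hab, h⟩ := IsAvoidanceFamily.exists_rat_Icc_subset hV hx
      obtain ⟨k, hk⟩ := hq (a, b)
      refine ⟨k + 1, k, k.lt_succ_self, ?_, ?_⟩ <;> rw [hk]
      · exact Ioo_subset_Icc_self.trans h
      · exact hab

theorem measure_subset_le_of_elementarySet {μ : Measure (Compacts ℝ)} {V : Set ℝ} (hV : IsOpen V)
    {c : ℝ≥0∞} (h : ∀ I, elementarySet I ⊆ V → μ {M | (M : Set ℝ) ⊆ elementarySet I} ≤ c) :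
    μ {M | (M : Set ℝ) ⊆ V} ≤ c := by
  obtain ⟨I, hI, rfl⟩ := exists_elementarySet_exhaustion hV
  have h1 : {M : Compacts ℝ | (M : Set ℝ) ⊆ ⋃ n, elementarySet (I n)}
      ⊆ ⋃ n, {M : Compacts ℝ | (M : Set ℝ) ⊆ elementarySet (I n)} := fun M hM =>
    mem_iUnion.2 (M.isCompact.elim_directed_cover _ (fun n => isOpen_elementarySet (I n)) hM
      hI.directed_le)
  refine (measure_mono h1).trans ?_
  rw [Monotone.measure_iUnion fun i j hij M hM => hM.trans (hI hij)]
  exact iSup_le fun n => h _ (subset_iUnion (fun n => elementarySet (I n)) n)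

/-- Continuity from above, which is where finiteness enters: each point of a finite set avoiding `⋂
V n` leaves the sequence at some index, and the largest of these indices works for the whole set. -/
theorem exists_measure_hit_lt {μ : Measure (Compacts ℝ)} [IsFiniteMeasure μ]
    (hμ : μ {M | ¬ (M : Set ℝ).Finite} = 0) {V : ℕ → Set ℝ} (hV : ∀ n, IsOpen (V n))
    (hanti : Antitone V) {ε : ℝ≥0∞} (h : μ {M | ((M : Set ℝ) ∩ ⋂ n, V n).Nonempty} < ε) :
    ∃ n, μ {M | ((M : Set ℝ) ∩ V n).Nonempty} < ε := by
  have h1 : (⋂ n, {M : Compacts ℝ | ((M : Set ℝ) ∩ V n).Nonempty})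
      ⊆ {M : Compacts ℝ | ((M : Set ℝ) ∩ ⋂ n, V n).Nonempty} ∪
        {M : Compacts ℝ | ¬ (M : Set ℝ).Finite} := by
    intro M hM
    rw [mem_iInter] at hM
    by_cases hfin : (M : Set ℝ).Finite
    swap
    · exact Or.inr hfin
    refine Or.inl ?_
    by_contra hne
    have h2 : ∀ x ∈ (M : Set ℝ), ∃ n, x ∉ V n := by
      intro x hx
      by_contra hx'
      push Not at hx'
      exact hne ⟨x, hx, mem_iInter.2 hx'⟩
    choose! k hk using h2
    obtain ⟨N, hN⟩ := (hfin.image k).bddAbove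
    obtain ⟨x, hx, hxN⟩ := hM N
    exact hk x hx (hanti (hN (mem_image_of_mem k hx)) hxN)
  have h2 := tendsto_measure_iInter_atTop (μ := μ)
    (s := fun n => {M : Compacts ℝ | ((M : Set ℝ) ∩ V n).Nonempty})
    (fun n => (measurableSet_compacts_of_isOpen
      (Compacts.isOpen_inter_nonempty_of_isOpen (hV n))).nullMeasurableSet)
    (fun i j hij M hM => hM.mono (inter_subset_inter_right _ (hanti hij)))
    ⟨0, measure_ne_top _ _⟩
  have h3 : μ (⋂ n, {M : Compacts ℝ | ((M : Set ℝ) ∩ V n).Nonempty}) < ε :=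
    ((measure_mono h1).trans (measure_union_le _ _)).trans_lt (by rwa [hμ, add_zero])
  exact ((tendsto_order.1 h2).2 ε h3).exists

/-- Induction over Borel sets. Complements exchange the roles of the closed and the open set, while
open sets and countable unions use continuity from above. -/
theorem exists_isClosed_isOpen_measure_hit_lt {μ : Measure (Compacts ℝ)} [IsFiniteMeasure μ]
    (hμ : μ {M | ¬ (M : Set ℝ).Finite} = 0) {E : Set ℝ} (hE : MeasurableSet E) :
    ∀ ε : ℝ≥0∞, ε ≠ 0 → ∃ C U : Set ℝ, IsClosed C ∧ IsOpen U ∧ C ⊆ E ∧ E ⊆ U ∧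
      μ {M | ((M : Set ℝ) ∩ (U \ C)).Nonempty} < ε := by
  induction E, hE using MeasurableSet.induction_on_open with
  | isOpen U hU =>
    intro ε hε
    obtain ⟨C, hC, hCU, hUC, hmono⟩ := hU.exists_iUnion_isClosed
    obtain ⟨n, hn⟩ := exists_measure_hit_lt hμ (V := fun n => U \ C n)
      (fun n => hU.sdiff (hC n)) (fun i j hij => sdiff_subset_sdiff_right (hmono hij)) (ε := ε) (by
        rw [← sdiff_iUnion, hUC]
        simpa using pos_iff_ne_zero.2 hε)
    exact ⟨C n, U, hC n, hU, hCU n, Subset.rfl, hn⟩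
  | compl E _ ih =>
    intro ε hε
    obtain ⟨C, U, hC, hU, hCE, hEU, h⟩ := ih ε hε
    refine ⟨Uᶜ, Cᶜ, hU.isClosed_compl, hC.isOpen_compl, compl_subset_compl.2 hEU,
      compl_subset_compl.2 hCE, ?_⟩
    rwa [show Cᶜ \ Uᶜ = U \ C by ext; simp [and_comm]]
  | iUnion E _ _ ih =>
    intro ε hε
    obtain ⟨δ, hδ, hsum⟩ := ENNReal.exists_pos_sum_of_countable' hε ℕ
    choose C U hC hU hCE hEU h using fun n => ih n (δ n) (hδ n).ne'
    have hclosed : ∀ n, IsClosed (⋃ i < n, C i) := fun n =>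
      (finite_lt_nat n).isClosed_biUnion fun i _ => hC i
    -- The union of all `C i` need not be closed, so finite unions are removed. What is left in the
    -- limit lies in `⋃ (U i \ C i)`, whose hitting mass is below `ε` by summation.
    obtain ⟨n, hn⟩ := exists_measure_hit_lt hμ (V := fun n => (⋃ i, U i) \ ⋃ i < n, C i)
      (fun n => (isOpen_iUnion hU).sdiff (hclosed n))
      (fun i j hij => sdiff_subset_sdiff_right
        (biUnion_subset_biUnion_left fun k hk => lt_of_lt_of_le hk hij)) (ε := ε) (by
        refine lt_of_le_of_lt ?_ hsum
        refine le_trans ?_ (ENNReal.tsum_le_tsum fun n => (h n).le)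
        refine le_trans (measure_mono ?_) (measure_iUnion_le _)
        rintro M ⟨x, hxM, hx⟩
        rw [mem_iInter] at hx
        obtain ⟨i, hi⟩ := mem_iUnion.1 (hx 0).1
        refine mem_iUnion.2 ⟨i, x, hxM, hi, fun hxC => (hx (i + 1)).2 ?_⟩
        exact mem_iUnion₂.2 ⟨i, i.lt_succ_self, hxC⟩)
    exact ⟨_, _, hclosed n, isOpen_iUnion hU,
      iUnion₂_subset fun i _ => (hCE i).trans (subset_iUnion _ i), iUnion_mono hEU, hn⟩

end FiniteSpectrum

/-! ### A classical factorization extends to Borel sets. -/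

section ClassicalExtension
open Filter Topology Set TopologicalSpace
open scoped ENNReal

namespace ContinuousFactorization

variable {Ω : Type*} {m : MeasurableSpace Ω} [mΩ : MeasurableSpace Ω] {P : Measure Ω}
  [IsProbabilityMeasure P] {F : ContinuousFactorization P}

theorem IsSpectralMeasure.measure_univ {f : Ω → ℝ} {μ : Measure (Compacts ℝ)}
    (h : F.IsSpectralMeasure f μ) (hf : MemLp f 2 P) :
    μ univ = ENNReal.ofReal (‖hf.toLp f‖ ^ 2) := by
  have := h {(⊥, ⊤)}
  rw [elementaryField_univ, elementarySet_univ, eLpNorm_condExp_eq le_rfl hf,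
    condProj_eq_self le_rfl (Lp.aestronglyMeasurable _)] at this
  simpa using this

theorem IsSpectralMeasure.measure_subset_isOpen_le {f : Ω → ℝ} {μ : Measure (Compacts ℝ)}
    (h : F.IsSpectralMeasure f μ) (hf : MemLp f 2 P) {V : Set ℝ} (hV : IsOpen V) :
    μ {M | (M : Set ℝ) ⊆ V} ≤ ENNReal.ofReal (‖condProj (F.openField V) P (hf.toLp f)‖ ^ 2) := by
  refine measure_subset_le_of_elementarySet hV fun I hI => ?_
  rw [h I, eLpNorm_condExp_eq (F.isSubSigmaField_elementaryField I).le hf]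
  refine ENNReal.ofReal_le_ofReal (pow_le_pow_left₀ (norm_nonneg _) ?_ 2)
  exact norm_condProj_mono (F.isSubSigmaField_openField V).le
    (F.elementaryField_le_openField hI) _

theorem IsSpectralMeasure.measure_subset_le {f : Ω → ℝ} {μ : Measure (Compacts ℝ)}
    (h : F.IsSpectralMeasure f μ) (hf : MemLp f 2 P) (K : Set ℝ) :
    μ {M | (M : Set ℝ) ⊆ K}
      ≤ ENNReal.ofReal (‖condProj (F.compactField K) P (hf.toLp f)‖ ^ 2) := by
  have h1 := condProj_tendsto_iInf (P := P) (fun _ => F.isSubSigmaField_openField _)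
    (F.openField_thickening_antitone K) (hf.toLp f)
  refine ge_of_tendsto' (ENNReal.tendsto_ofReal (h1.norm.pow 2)) fun n => ?_
  refine le_trans (measure_mono fun M hM => ?_)
    (h.measure_subset_isOpen_le hf Metric.isOpen_thickening)
  exact hM.trans (Metric.self_subset_thickening (by positivity) _)

/-- In a classical factorization the σ-fields of a countable cover generate everything. -/
theorem IsClassical.le_of_iUnion_eq_univ (hF : F.IsClassical) {E : ℕ → Set ℝ}
    (hE : ∀ n, MeasurableSet (E n)) (huniv : ⋃ n, E n = univ) (hm : m ≤ mΩ)
    (h : ∀ n, F.borelField (E n) ≤ m) : mΩ ≤ m := by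
  have hmS : IsSubSigmaField P m := (F.isSubSigmaField_borelField (E 0)).mono (h 0) hm
  intro s hs
  have hf := memLp_indicator_one (P := P) hs
  obtain ⟨μ, hspec, hfin⟩ := hF _ hf
  have htot := hspec.measure_univ hf
  have hμ : IsFiniteMeasure μ := ⟨by rw [htot]; exact ENNReal.ofReal_lt_top⟩
  -- Once the projection is known not to decrease the norm, Pythagoras shows that it fixes the
  -- indicator of `s`, which puts `s` in `m`.
  have key : ENNReal.ofReal (‖hf.toLp _‖ ^ 2)
      ≤ ENNReal.ofReal (‖condProj m P (hf.toLp _)‖ ^ 2) := by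
    rw [← htot]
    refine ENNReal.le_of_forall_pos_le_add fun ε hε _ => ?_
    obtain ⟨δ, hδ, hsum⟩ := ENNReal.exists_pos_sum_of_countable'
      (ENNReal.coe_ne_zero.2 hε.ne') ℕ
    -- The cover is made disjoint first, since σ-fields of compact unions are controlled only for
    -- disjoint pieces. Truncating to `[-N, N]` then makes the closed sets compact.
    choose C U hC _ hCE hEU hCU using fun n =>
      exists_isClosed_isOpen_measure_hit_lt hfin (MeasurableSet.disjointed hE n) (δ n) (hδ n).ne'
    let K : ℕ → ℕ → Set ℝ := fun N i => C i ∩ Icc (-(N : ℝ)) N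
    have hK : ∀ N i, IsCompact (K N i) := fun N i => isCompact_Icc.inter_left (hC i)
    have hKE : ∀ N i, K N i ⊆ E i := fun N i =>
      inter_subset_left.trans ((hCE i).trans (disjointed_subset E i))
    have hle : ∀ N, F.compactField (⋃ i < N, K N i) ≤ m := by
      intro N
      refine F.compactField_biUnion_le (hK N) (fun i j hij => ?_) ?_ (fun i => ?_) N
      · exact (disjoint_disjointed E hij).mono (inter_subset_left.trans (hCE i))
          (inter_subset_left.trans (hCE j))
      · exact (F.compactField_le_borelField isCompact_empty (empty_subset (E 0))).trans (h 0)
      · exact (F.compactField_le_borelField (hK N i) (hKE N i)).trans (h i)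
    have hmono : Monotone fun N => {M : Compacts ℝ | (M : Set ℝ) ⊆ ⋃ i < N, K N i} := by
      intro N N' hN M hM
      have hN' : (N : ℝ) ≤ N' := Nat.cast_le.2 hN
      refine hM.trans (iUnion₂_subset fun i hi x hx => ?_)
      exact mem_iUnion₂.2 ⟨i, hi.trans_le hN, hx.1,
        Icc_subset_Icc (neg_le_neg hN') hN' hx.2⟩
    -- A finite set that hits no `U n \ C n` has each of its points in some truncated piece, hence
    -- lies in one of the increasing compact unions.
    have hcov : (univ : Set (Compacts ℝ)) ⊆
        ((⋃ N, {M : Compacts ℝ | (M : Set ℝ) ⊆ ⋃ i < N, K N i}) ∪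
          ⋃ n, {M : Compacts ℝ | ((M : Set ℝ) ∩ (U n \ C n)).Nonempty}) ∪
          {M : Compacts ℝ | ¬ (M : Set ℝ).Finite} := by
      intro M _
      by_cases hMfin : (M : Set ℝ).Finite
      swap
      · exact Or.inr hMfin
      by_cases hhit : M ∈ ⋃ n, {M : Compacts ℝ | ((M : Set ℝ) ∩ (U n \ C n)).Nonempty}
      · exact Or.inl (Or.inr hhit)
      refine Or.inl (Or.inl ?_)
      have hx : ∀ x ∈ (M : Set ℝ), ∃ N i : ℕ, i < N ∧ x ∈ K N i := by
        intro x hx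
        have : x ∈ ⋃ n, disjointed E n := by rw [iUnion_disjointed, huniv]; trivial
        obtain ⟨i, hi⟩ := mem_iUnion.1 this
        have hxC : x ∈ C i := by
          by_contra hxC
          exact hhit (mem_iUnion.2 ⟨i, x, hx, hEU i hi, hxC⟩)
        obtain ⟨N, hN⟩ := exists_nat_ge |x|
        have hN' := abs_le.1 (hN.trans
          (Nat.cast_le.2 (le_max_left N (i + 1)) : (N : ℝ) ≤ (max N (i + 1) : ℕ)))
        exact ⟨max N (i + 1), i, lt_max_of_lt_right i.lt_succ_self, hxC, hN'⟩
      choose! k i hik hxk using hx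
      obtain ⟨N, hN⟩ := (hMfin.image k).bddAbove
      refine mem_iUnion.2 ⟨N, fun x hx => ?_⟩
      have hkN : k x ≤ N := hN (mem_image_of_mem k hx)
      have hkN' : (k x : ℝ) ≤ N := Nat.cast_le.2 hkN
      exact mem_iUnion₂.2 ⟨i x, (hik x hx).trans_le hkN, (hxk x hx).1,
        Icc_subset_Icc (neg_le_neg hkN') hkN' (hxk x hx).2⟩
    refine (measure_mono hcov).trans ((measure_union_le _ _).trans ?_)
    rw [hfin, add_zero]
    refine (measure_union_le _ _).trans (add_le_add ?_ ?_)
    · rw [hmono.measure_iUnion]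
      refine iSup_le fun N => (hspec.measure_subset_le hf _).trans ?_
      exact ENNReal.ofReal_le_ofReal (pow_le_pow_left₀ (norm_nonneg _)
        (norm_condProj_mono hm (hle N) _) 2)
    · exact (measure_iUnion_le _).trans
        ((ENNReal.tsum_le_tsum fun n => (hCU n).le).trans hsum.le)
  have key' := (ENNReal.ofReal_le_ofReal_iff (sq_nonneg _)).1 key
  have hpy := condProj_norm_sq (m := m) (hf.toLp _)
  have hz : ‖hf.toLp _ - condProj m P (hf.toLp _)‖ ^ 2 = 0 :=
    le_antisymm (by linarith) (sq_nonneg _)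
  have heq : hf.toLp _ = condProj m P (hf.toLp _) :=
    sub_eq_zero.1 (norm_eq_zero.1 (pow_eq_zero_iff two_ne_zero |>.1 hz))
  have hae := condProj_toLp hm hf
  rw [← heq] at hae
  exact hmS.measurableSet_of_condExp hs stronglyMeasurable_condExp (hf.coeFn_toLp.symm.trans hae)

/-- The sets `E₁`, `E₂` and `(E₁ ∪ E₂)ᶜ` cover the line, so their σ-fields generate everything; the
last being independent of the σ-field of `E₁ ∪ E₂`, the first two must generate the latter. -/
theorem IsClassical.borelField_union (hF : F.IsClassical) {E₁ E₂ : Set ℝ}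
    (h₁ : MeasurableSet E₁) (h₂ : MeasurableSet E₂) :
    F.borelField (E₁ ∪ E₂) = F.borelField E₁ ⊔ F.borelField E₂ := by
  have hle := fun E => (F.isSubSigmaField_borelField E).le
  refine (eq_of_indep_of_sup_eq ((F.isSubSigmaField_borelField E₁).sup (hle E₂)) (hle _)
    (hle (E₁ ∪ E₂)ᶜ) (sup_le (F.borelField_mono subset_union_left)
      (F.borelField_mono subset_union_right)) (F.indep_borelField disjoint_compl_right)
    ((hle _).trans ?_)).symm
  refine hF.le_of_iUnion_eq_univ
    (E := fun n => Nat.casesOn n E₁ fun n => Nat.casesOn n E₂ fun _ => (E₁ ∪ E₂)ᶜ)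
    ?_ ?_ (sup_le (sup_le (hle _) (hle _)) (hle _)) ?_
  · rintro (_ | _ | _)
    exacts [h₁, h₂, (h₁.union h₂).compl]
  · refine eq_univ_of_forall fun x => mem_iUnion.2 ?_
    by_cases hx₁ : x ∈ E₁
    · exact ⟨0, hx₁⟩
    by_cases hx₂ : x ∈ E₂
    · exact ⟨1, hx₂⟩
    · exact ⟨2, fun h => h.elim hx₁ hx₂⟩
  · rintro (_ | _ | _)
    exacts [le_sup_left.trans le_sup_left, le_sup_right.trans le_sup_left, le_sup_right]

theorem IsClassical.borelField_iUnion (hF : F.IsClassical) {E : ℕ → Set ℝ}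
    (hE : ∀ n, MeasurableSet (E n)) : F.borelField (⋃ n, E n) = ⨆ n, F.borelField (E n) := by
  have hle := fun E => (F.isSubSigmaField_borelField E).le
  refine (eq_of_indep_of_sup_eq (IsSubSigmaField.iSup fun n => F.isSubSigmaField_borelField (E n))
    (hle _) (hle (⋃ n, E n)ᶜ) (iSup_le fun n => F.borelField_mono (subset_iUnion E n))
    (F.indep_borelField disjoint_compl_right) ((hle _).trans ?_)).symm
  refine hF.le_of_iUnion_eq_univ (E := fun n => Nat.casesOn n (⋃ n, E n)ᶜ E)
    ?_ ?_ (sup_le (iSup_le fun n => hle _) (hle _)) ?_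
  · rintro (_ | n)
    exacts [(MeasurableSet.iUnion hE).compl, hE n]
  · refine eq_univ_of_forall fun x => mem_iUnion.2 ?_
    by_cases hx : x ∈ ⋃ n, E n
    · obtain ⟨n, hn⟩ := mem_iUnion.1 hx
      exact ⟨n + 1, hn⟩
    · exact ⟨0, hx⟩
  · rintro (_ | n)
    exacts [le_sup_right, (le_iSup (fun n => F.borelField (E n)) n).trans le_sup_left]

theorem IsClassical.borelField_le_of_finite (hF : F.IsClassical) {A : Set ℝ} (hA : A.Finite) :
    F.borelField A ≤ degenerateField P := by
  induction A, hA using Set.Finite.induction_on with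
  | empty => exact (F.borelField_mono (empty_subset {0})).trans (F.borelField_singleton_le 0)
  | @insert a A _ hA ih =>
    rw [insert_eq, hF.borelField_union (measurableSet_singleton a) hA.measurableSet]
    exact sup_le (F.borelField_singleton_le a) ih

theorem IsClassical.borelField_union_of_finite_diff (hF : F.IsClassical) {A B : Set ℝ}
    (hA : MeasurableSet A) (hBA : (B \ A).Finite) : F.borelField (A ∪ B) = F.borelField A := by
  rw [← union_sdiff_self, hF.borelField_union hA hBA.measurableSet, sup_eq_left]
  exact (hF.borelField_le_of_finite hBA).trans (F.isSubSigmaField_borelField A).degenerateField_le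

theorem IsClassical.isBorelExtension (hF : F.IsClassical) : F.IsBorelExtension F.borelField where
  isSubSigmaField E _ := F.isSubSigmaField_borelField E
  eq_elementaryField I E hE := by
    have hO := isOpen_elementarySet I
    have h1 : (E \ elementarySet I).Finite := hE.subset subset_union_left
    have h2 : (elementarySet I \ E).Finite := hE.subset subset_union_right
    have hEm : MeasurableSet E := by
      have : E = (elementarySet I \ (elementarySet I \ E)) ∪ (E \ elementarySet I) := by
        ext x
        by_cases hx : x ∈ elementarySet I <;> simp [hx]
      rw [this]
      exact (hO.measurableSet.diff h2.measurableSet).union h1.measurableSet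
    rw [← hF.borelField_union_of_finite_diff hEm h2, union_comm,
      hF.borelField_union_of_finite_diff hO.measurableSet h1, F.borelField_of_isOpen hO,
      F.openField_elementarySet]
  indep _ _ _ _ h := F.indep_borelField h
  union _ _ h₁ h₂ _ := hF.borelField_union h₁ h₂
  iUnion _ hE _ := hF.borelField_iUnion hE

end ContinuousFactorization
end ClassicalExtension

theorem theorem6p21 {Ω : Type*} [MeasurableSpace Ω] (P : Measure Ω) [IsProbabilityMeasure P]
    (F : ContinuousFactorization P) :
    F.IsClassical ↔ ∃ G : Set ℝ → MeasurableSpace Ω, F.IsBorelExtension G :=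
  ⟨fun h => ⟨F.borelField, h.isBorelExtension⟩, fun ⟨_, hG⟩ => hG.isClassical⟩
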